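/- Let $X$ be a real Hilbert space, $N\ge 1$ an integer, $(\tau^j_n)_{n\in\mathbb N}$, $j=1,\dots,N$, sequences of invertible linear isometries of $X$, and $\tau_n^{k/j}=\tau_n^k(\tau_n^j)^{-1}$. Let $A$, $B^j$ ($j=1,\dots,N$) and $R_n$ ($n\in\mathbb N$) be (possibly unbounded) linear operators in $X$, and set $B^j_n=(\tau^j_n)^{-1}B^j\tau^j_n$ and $L_n=A+\sum_{j=1}^N B^j_n+R_n$ (sums and products of operators have their natural domains). For an operator $T$ in $X$, the resolvent set $\rho(T)\subset\mathbb C$, the spectrum $\sigma(T)=\mathbb C\setminus\rho(T)$ and the resolvent are those of its complex-linear extension to the complexification of $X$. If the circle $|\mu-\lambda|=\varepsilon$ lies in $\rho(T)$, let $P_{\lambda,\varepsilon}(T)=\frac1{2\pi i}\oint_{|\mu-\lambda|=\varepsilon}(\mu-T)^{-1}\,d\mu$ (counterclockwise) be the corresponding Riesz spectral projection; the dimension of its range is over $\mathbb C$. Assume: (A1) For all $j$ and $n$, the operators $A$, $A+B^j$, $A+B^j_n$, $L_n$ are self-adjoint with the same domain $D(A)$. (A2) $A$ is invertible with bounded inverse,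 and $(\tau^j_n)^{-1}A\tau^j_n=A$ for all $j$ and $n$. (A3) There is $\delta>0$ such that for all $j$ and $n$ the spectrum in $(-\infty,\delta)$ of each of $A$, $A+B^j$, $A+B^j_n$, $L_n$ consists of finitely many eigenvalues of finite geometric multiplicity. (A4) For every $\mu\in\bigcap_{j=1}^N\rho(A+B^j)$ and every $j$, the operator $A(A+B^j-\mu)^{-1}$ is bounded. (A5) The operators $R_nA^{-1}$ are bounded and $\|R_nA^{-1}\|\to0$ as $n\to\infty$. (A6) For all $u\in D(A)$ and $j\ne l$, $\|\tau_n^{j/l}B^l\tau_n^{l/j}u\|\to0$ as $n\to\infty$. (A7) For all $u\in X$ and $j\ne k$, $\tau_n^{j/k}u\rightharpoonup0$ weakly in $X$ as $n\to\infty$. (A8) For every $j$, the operator $B^jA^{-1}$ is compact. Let $\lambda<\delta$ be real, with $\delta$ as in (A3). Then: 1. If $\lambda\in\bigcap_{j=1}^N\rho(A+B^j)$, there is $n_\lambda\in\mathbb N$ such that $\lambda\in\rho(L_n)$ for all $n\ge n_\lambda$. 2. If $\lambda\in\bigcup_{j=1}^N\sigma(A+B^j)$, there is $\varepsilon_0>0$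 such that for every $0<\varepsilon<\varepsilon_0$ the circle $|\mu-\lambda|=\varepsilon$ lies in $\rho(A+B^j)$ and $P_{\lambda,\varepsilon}(A+B^j)$ has finite rank for every $j$, and there is $n_\varepsilon\in\mathbb N$ such that for all $n\ge n_\varepsilon$ the circle lies in $\rho(L_n)$, $P_{\lambda,\varepsilon}(L_n)$ has finite rank, and $$\dim\operatorname{Range}P_{\lambda,\varepsilon}(L_n)=\sum_{j=1}^N\dim\operatorname{Range}P_{\lambda,\varepsilon}(A+B^j).$$ -/

import Mathlib

open Filter Topology

noncomputable section

namespace AsymptoticInertia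

/-- The complexification `X ⊕ iX` of a real Hilbert space `X`: a pair `(x, y)` stands for
`x + i y`, and the norm is `‖x + i y‖² = ‖x‖² + ‖y‖²`. -/
def Complexification (X : Type*) : Type _ := WithLp 2 (X × X)

namespace Complexification

variable {X : Type*}

/-- The vector `x + i y`. -/
def mk (x y : X) : Complexification X := WithLp.toLp 2 (x, y)

/-- The real part of a vector. -/
def re (z : Complexification X) : X := WithLp.fst (p := 2) (α := X) (β := X) z

/-- The imaginary part of a vector. -/
def im (z : Complexification X) : X := WithLp.snd (p := 2) (α := X) (β := X) z

theorem ext {z w : Complexification X} (h₁ : z.re = w.re) (h₂ : z.im = w.im) : z = w :=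
  WithLp.ofLp_injective 2 (Prod.ext h₁ h₂)

@[simp] theorem re_mk (x y : X) : (mk x y).re = x := rfl
@[simp] theorem im_mk (x y : X) : (mk x y).im = y := rfl

variable [NormedAddCommGroup X]

instance instNormedAddCommGroup : NormedAddCommGroup (Complexification X) :=
  inferInstanceAs (NormedAddCommGroup (WithLp 2 (X × X)))

instance instCompleteSpace [CompleteSpace X] : CompleteSpace (Complexification X) :=
  inferInstanceAs (CompleteSpace (WithLp 2 (X × X)))

@[simp] theorem re_zero : (0 : Complexification X).re = 0 := rfl
@[simp] theorem im_zero : (0 : Complexification X).im = 0 := rfl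
@[simp] theorem re_add (z w : Complexification X) : (z + w).re = z.re + w.re := rfl
@[simp] theorem im_add (z w : Complexification X) : (z + w).im = z.im + w.im := rfl

theorem norm_sq_eq (z : Complexification X) : ‖z‖ ^ 2 = ‖z.re‖ ^ 2 + ‖z.im‖ ^ 2 :=
  WithLp.prod_norm_sq_eq_of_L2 (α := X) (β := X) z

variable [InnerProductSpace ℝ X]

instance instSMul : SMul ℂ (Complexification X) :=
  ⟨fun c z => mk (c.re • z.re - c.im • z.im) (c.re • z.im + c.im • z.re)⟩

@[simp] theorem re_smul (c : ℂ) (z : Complexification X) :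
    (c • z).re = c.re • z.re - c.im • z.im := rfl
@[simp] theorem im_smul (c : ℂ) (z : Complexification X) :
    (c • z).im = c.re • z.im + c.im • z.re := rfl

instance instModule : Module ℂ (Complexification X) where
  one_smul z := ext (by simp) (by simp)
  mul_smul a b z := ext
    (by simp only [re_smul, im_smul, Complex.mul_re, Complex.mul_im]; module)
    (by simp only [re_smul, im_smul, Complex.mul_re, Complex.mul_im]; module)
  smul_zero a := ext (by simp) (by simp)
  smul_add a z w := ext
    (by simp only [re_smul, re_add, im_add]; module)
    (by simp only [im_smul, re_add, im_add]; module)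
  add_smul a b z := ext
    (by simp only [re_smul, re_add, Complex.add_re, Complex.add_im]; module)
    (by simp only [im_smul, im_add, Complex.add_re, Complex.add_im]; module)
  zero_smul z := ext (by simp) (by simp)

theorem norm_smul_eq (c : ℂ) (z : Complexification X) : ‖c • z‖ = ‖c‖ * ‖z‖ := by
  have h : ‖c • z‖ ^ 2 = (‖c‖ * ‖z‖) ^ 2 := by
    rw [mul_pow, norm_sq_eq, norm_sq_eq, Complex.sq_norm, Complex.normSq_apply, re_smul, im_smul,
      norm_sub_sq_real, norm_add_sq_real]
    simp only [norm_smul, mul_pow, Real.norm_eq_abs, sq_abs, real_inner_smul_left,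
      real_inner_smul_right, real_inner_comm z.re z.im]
    ring
  exact (sq_eq_sq₀ (norm_nonneg _) (by positivity)).1 h

instance instNormedSpace : NormedSpace ℂ (Complexification X) where
  norm_smul_le c z := (norm_smul_eq c z).le

/-- The Hermitian inner product on the complexification (antilinear in the first variable). -/
instance instInnerProductSpace : InnerProductSpace ℂ (Complexification X) where
  inner z w := ⟨inner ℝ z.re w.re + inner ℝ z.im w.im, inner ℝ z.re w.im - inner ℝ z.im w.re⟩
  norm_sq_eq_re_inner z := by
    simp [norm_sq_eq]
  conj_inner_symm z w := by
    apply Complex.ext <;> simp [real_inner_comm]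
  add_left x y z := by
    apply Complex.ext <;> simp [inner_add_left] <;> ring
  smul_left x y r := by
    apply Complex.ext <;>
      simp [inner_add_left, inner_sub_left, real_inner_smul_left] <;> ring

end Complexification

section Operators

variable {𝕜 E : Type*} [RCLike 𝕜] [NormedAddCommGroup E] [InnerProductSpace 𝕜 E]

/-- The product `S T` of two unbounded operators, on its natural domain
`{x ∈ D(T) | T x ∈ D(S)}`. -/
def opComp (S T : E →ₗ.[𝕜] E) : E →ₗ.[𝕜] E where
  domain :=
    { carrier := {x | ∃ hx : x ∈ T.domain, T ⟨x, hx⟩ ∈ S.domain}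
      zero_mem' := ⟨T.domain.zero_mem, by
        have h : T ⟨0, T.domain.zero_mem⟩ = 0 := T.map_zero
        rw [h]; exact S.domain.zero_mem⟩
      add_mem' := by
        rintro a b ⟨ha, ha'⟩ ⟨hb, hb'⟩
        refine ⟨T.domain.add_mem ha hb, ?_⟩
        have h : T ⟨a + b, T.domain.add_mem ha hb⟩ = T ⟨a, ha⟩ + T ⟨b, hb⟩ :=
          T.map_add ⟨a, ha⟩ ⟨b, hb⟩
        rw [h]; exact S.domain.add_mem ha' hb'
      smul_mem' := by
        rintro c a ⟨ha, ha'⟩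
        refine ⟨T.domain.smul_mem c ha, ?_⟩
        have h : T ⟨c • a, T.domain.smul_mem c ha⟩ = c • T ⟨a, ha⟩ := T.map_smul c ⟨a, ha⟩
        rw [h]; exact S.domain.smul_mem c ha' }
  toFun :=
    { toFun := fun x => S ⟨T ⟨x, x.2.fst⟩, x.2.snd⟩
      map_add' := by
        intro x y
        rw [← S.map_add]
        exact congrArg S (Subtype.ext (T.map_add ⟨x, x.2.fst⟩ ⟨y, y.2.fst⟩))
      map_smul' := by
        intro c x
        rw [RingHom.id_apply, ← S.map_smul]
        exact congrArg S (Subtype.ext (T.map_smul c ⟨x, x.2.fst⟩)) }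

/-- The unbounded operator `T` is everywhere defined and given by the bounded operator `C`. -/
def IsGivenBy (T : E →ₗ.[𝕜] E) (C : E →L[𝕜] E) : Prop :=
  T = (C : E →ₗ[𝕜] E).toPMap ⊤

/-- The bounded operator `S` is a two-sided inverse of `T - μ : D(T) → E`. -/
def IsResolventAt (T : E →ₗ.[𝕜] E) (μ : 𝕜) (S : E →L[𝕜] E) : Prop :=
  (∀ y : E, ∃ h : S y ∈ T.domain, T ⟨S y, h⟩ - μ • S y = y) ∧
    ∀ x : T.domain, S (T x - μ • (x : E)) = x

end Operators

section RealOperators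

variable {X : Type*} [NormedAddCommGroup X] [InnerProductSpace ℝ X]

/-- The conjugate `τ⁻¹ T τ` of an unbounded operator `T` by a surjective linear isometry `τ`, with
domain `{x | τ x ∈ D(T)}`. -/
def conj (τ : X ≃ₗᵢ[ℝ] X) (T : X →ₗ.[ℝ] X) : X →ₗ.[ℝ] X where
  domain := T.domain.comap (τ.toLinearEquiv : X →ₗ[ℝ] X)
  toFun :=
    { toFun := fun x => τ.symm (T ⟨τ x, x.2⟩)
      map_add' := by
        intro x y
        rw [← map_add, ← T.map_add]
        exact congrArg τ.symm (congrArg T (Subtype.ext (map_add τ (x : X) (y : X))))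
      map_smul' := by
        intro c x
        rw [RingHom.id_apply, ← map_smul, ← T.map_smul]
        exact congrArg τ.symm (congrArg T (Subtype.ext (map_smul τ c (x : X)))) }

/-- The composition `τ^{k/j} = τ^k (τ^j)⁻¹`, for `σ = τ^k` and `τ = τ^j`. -/
def isomQuot (σ τ : X ≃ₗᵢ[ℝ] X) : X ≃ₗᵢ[ℝ] X := τ.symm.trans σ

/-- The complex-linear extension `T (x + i y) = T x + i T y` of a real operator `T` to the
complexification, with domain `D(T) + i D(T)`. -/
def complexify (T : X →ₗ.[ℝ] X) : Complexification X →ₗ.[ℂ] Complexification X where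
  domain :=
    { carrier := {z | z.re ∈ T.domain ∧ z.im ∈ T.domain}
      zero_mem' := ⟨T.domain.zero_mem, T.domain.zero_mem⟩
      add_mem' := fun ha hb => ⟨T.domain.add_mem ha.1 hb.1, T.domain.add_mem ha.2 hb.2⟩
      smul_mem' := fun c _ ha =>
        ⟨T.domain.sub_mem (T.domain.smul_mem c.re ha.1) (T.domain.smul_mem c.im ha.2),
          T.domain.add_mem (T.domain.smul_mem c.re ha.2) (T.domain.smul_mem c.im ha.1)⟩ }
  toFun :=
    { toFun := fun z => Complexification.mk (T ⟨_, z.2.1⟩) (T ⟨_, z.2.2⟩)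
      map_add' := fun z w => Complexification.ext
        (T.map_add ⟨_, z.2.1⟩ ⟨_, w.2.1⟩) (T.map_add ⟨_, z.2.2⟩ ⟨_, w.2.2⟩)
      map_smul' := fun c z => Complexification.ext
        ((T.map_sub (c.re • ⟨_, z.2.1⟩) (c.im • ⟨_, z.2.2⟩)).trans
          (congrArg₂ (· - ·) (T.map_smul c.re ⟨_, z.2.1⟩) (T.map_smul c.im ⟨_, z.2.2⟩)))
        ((T.map_add (c.re • ⟨_, z.2.2⟩) (c.im • ⟨_, z.2.1⟩)).trans
          (congrArg₂ (· + ·) (T.map_smul c.re ⟨_, z.2.2⟩) (T.map_smul c.im ⟨_, z.2.1⟩))) }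

/-- The resolvent set `ρ(T) ⊆ ℂ` of an operator on a real Hilbert space: the `μ ∈ ℂ` for which
`T - μ`, on the complexification, is a bijection from the domain with bounded inverse. -/
def resolventSet (T : X →ₗ.[ℝ] X) : Set ℂ :=
  {μ | ∃ S : Complexification X →L[ℂ] Complexification X, IsResolventAt (complexify T) μ S}

/-- The spectrum `σ(T) = ℂ \ ρ(T)`. -/
def spectrum (T : X →ₗ.[ℝ] X) : Set ℂ := (resolventSet T)ᶜ

open scoped Classical in
/-- The resolvent `(T - μ)⁻¹` for `μ ∈ ρ(T)` (and `0` for other `μ`). -/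
def resolvent (T : X →ₗ.[ℝ] X) (μ : ℂ) : Complexification X →L[ℂ] Complexification X :=
  if h : μ ∈ resolventSet T then h.choose else 0

/-- The Riesz spectral projection `(2πi)⁻¹ ∮ (μ - T)⁻¹ dμ` of `T` for the positively oriented circle
of centre `c` and radius `ε`. -/
def rieszProjection (T : X →ₗ.[ℝ] X) (c : ℂ) (ε : ℝ) :
    Complexification X →L[ℂ] Complexification X :=
  (2 * Real.pi * Complex.I : ℂ)⁻¹ • ∮ μ in C(c, ε), -resolvent T μ

/-- The range of the Riesz spectral projection, a complex subspace of the complexification. -/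
def rieszRange (T : X →ₗ.[ℝ] X) (c : ℂ) (ε : ℝ) : Submodule ℂ (Complexification X) :=
  LinearMap.range (rieszProjection T c ε : Complexification X →ₗ[ℂ] Complexification X)

/-- The eigenspace `ker (T - s)` of `T` in `X`. -/
def eigenspace (T : X →ₗ.[ℝ] X) (s : ℝ) : Submodule ℝ X :=
  (LinearMap.ker (T.toFun - s • T.domain.subtype)).map T.domain.subtype

/-- The spectrum of `T` in `(-∞, δ)` consists of finitely many eigenvalues of finite geometric
multiplicity. -/
def FiniteSpectrumBelow (T : X →ₗ.[ℝ] X) (δ : ℝ) : Prop :=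
  {s : ℝ | s < δ ∧ (s : ℂ) ∈ spectrum T}.Finite ∧
    ∀ s : ℝ, s < δ → (s : ℂ) ∈ spectrum T →
      eigenspace T s ≠ ⊥ ∧ FiniteDimensional ℝ (eigenspace T s)

/-- The operator `L_n = A + ∑ⱼ Bʲ_n + R_n`, where `Bʲ_n = (τʲ_n)⁻¹ Bʲ τʲ_n`. -/
def fullOp {N : ℕ} (A : X →ₗ.[ℝ] X) (B : Fin N → X →ₗ.[ℝ] X) (R : ℕ → X →ₗ.[ℝ] X)
    (τ : Fin N → ℕ → X ≃ₗᵢ[ℝ] X) (n : ℕ) : X →ₗ.[ℝ] X :=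
  A + ∑ j, conj (τ j n) (B j) + R n

end RealOperators

end AsymptoticInertia

end

/-!
All operators involved have the form `(1 + bounded) A` with the common bounded inverse `G = A⁻¹`,
so that `(A + Bʲ - μ) G = 1 + Kⱼ - μ G` and `(Lₙ - μ) G = 1 + ∑ⱼ τⱼ⁻¹ Kⱼ τⱼ + Cₙ - μ G`, where `Kⱼ
= Bʲ A⁻¹` is compact, `Cₙ = Rₙ A⁻¹` tends to zero in norm and `G` commutes with the isometries.

The analytic core is a concentration argument. Let `fₙ` be bounded with `(Lₙ - μₙ) G fₙ → 0` and
`μₙ → μ < δ`. Along an ultrafilter, each `τⱼ fₙ` has a weak limit `gⱼ`; since `Kⱼ` is compact and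
the frames separate weakly, `(A + Bʲ - μ) G gⱼ = 0` (`weakLimit_solves`). If all `gⱼ` vanish, then
`(A - μ) G fₙ → 0`, and `fₙ → 0` because `A` has only isolated eigenvalues of finite multiplicity
below `δ` (`tendsto_zero_of_sub_smul_tendsto_zero`). So normalized eigenvectors of `Lₙ` leave a
nonzero eigenvector of some `A + Bʲ` in the limit. This excludes spectrum of `Lₙ` on compact parts
of the common resolvent set (`eventually_mem_resolventSet`), which gives the first claim.

For the second claim, the spectrum of `Lₙ` inside the circle shrinks to `λ`. The concentration
argument then makes the map from the spectral subspace of `Lₙ` to the product of the limit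
eigenspaces (project each `τⱼ fₙ`) injective for large `n` (`eventually_finrank_le`). Conversely
the sums `∑ⱼ τⱼ⁻¹ φⱼ` of translated limit eigenvectors are approximate eigenvectors of `Lₙ`, and
since `Lₙ - λ` is bounded below by `ε` on the complement of the spectral subspace, their
projections to it stay independent (`eventually_le_finrank`).

The link with Riesz projections is `finrank_rieszRange_and_estimates`: the continuous functional
calculus of the resolvent at `λ + ε` gives the spectral projection of the part inside the circle,
and Cauchy's theorem identifies it with the contour integral. Its range is the complexification of
the sum of the real eigenspaces inside the circle.
-/

namespace AsymptoticInertia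

/-! ### Splitting a bounded self-adjoint operator at a spectral gap -/

section BoundedSpectral

variable {H : Type*} [NormedAddCommGroup H] [InnerProductSpace ℂ H]

/-- A function continuous to the right of a spectral gap is continuous on the whole spectrum, if
only finitely many spectral points lie to the left of the gap. -/
theorem continuousOn_spectrum_of_finite_left {S : H →L[ℂ] H} {F : Finset ℝ} {b : ℝ}
    (hσ : _root_.spectrum ℝ S ⊆ ↑F ∪ Set.Ici b) {f : ℝ → ℝ} (hf : ContinuousOn f (Set.Ici b)) :
    ContinuousOn f (_root_.spectrum ℝ S) :=
  ((F.finite_toSet.continuousOn f).union_of_isClosed hf F.finite_toSet.isClosed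
    isClosed_Ici).mono hσ

/-- Splitting of a bounded self-adjoint operator `S` at a gap `-1/(2ε)` of its spectrum with
only finitely many spectral points `F` to the left. Here `e` is the spectral projection to the
left part and `E x` are the spectral projections of the points of `F`. The gap is meant for `S =
(T - (l + ε))⁻¹`: then `x = (s - (l + ε))⁻¹ < -1/(2ε)` means `|s - l| < ε`, so that `e` belongs
to the spectrum of `T` in `(l - ε, l + ε)`, and the operators `D` and `Q` represent `(T - l) e`
and `(T - l)⁻¹ (1 - e)`. -/
theorem exists_spectral_splitting [CompleteSpace H] {S : H →L[ℂ] H}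
    (hS : IsSelfAdjoint S) {ε : ℝ} (hε : 0 < ε)
    {F : Finset ℝ} (hσ : _root_.spectrum ℝ S ⊆ ↑F ∪ Set.Ici (-(2 * ε)⁻¹))
    (hgap : -(2 * ε)⁻¹ ∉ _root_.spectrum ℝ S) :
    ∃ (e : H →L[ℂ] H) (E : ℝ → H →L[ℂ] H) (D Q : H →L[ℂ] H),
      e = ∑ x ∈ F, E x ∧ (∀ x ∈ F, S * E x = (x : ℂ) • E x) ∧
      S * e = e * S ∧ e * e = e ∧ IsSelfAdjoint e ∧
      (∀ x : ℝ, x < -(2 * ε)⁻¹ → ∀ v, S v = (x : ℂ) • v → e v = v) ∧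
      ‖D‖ ≤ ε ∧ S * D = e * (1 + (ε : ℂ) • S) ∧
      ‖Q‖ ≤ ε⁻¹ ∧ Q * (1 + (ε : ℂ) • S) = S * (1 - e) ∧
      ∀ z : ℂ, ‖z + ε‖ ≤ ε → IsUnit (1 - z • (S * (1 - e))) := by
  set a : ℝ := (2 * ε)⁻¹ with ha
  have ha0 : 0 < a := by positivity
  have hεa : ε * a = 1 / 2 := by rw [ha]; field_simp
  have cont : ∀ {f : ℝ → ℝ}, ContinuousOn f (Set.Ici (-a)) →
      ContinuousOn f (_root_.spectrum ℝ S) := continuousOn_spectrum_of_finite_left hσ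
  let χ : ℝ → ℝ := fun x => if x < -a then 1 else 0
  have hχ0 : ∀ x ∈ Set.Ici (-a), χ x = 0 := fun x hx => if_neg (not_lt.2 hx)
  have hχ1 : ∀ {x}, x < -a → χ x = 1 := fun hx => if_pos hx
  have contχ : ∀ g : ℝ → ℝ, ContinuousOn (fun x => χ x * g x) (_root_.spectrum ℝ S) := fun g =>
    cont ((continuousOn_const (c := (0 : ℝ))).congr fun x hx => by simp [hχ0 x hx])
  have cχ : ContinuousOn χ (_root_.spectrum ℝ S) := by simpa using contχ 1
  have cid : ContinuousOn (fun x : ℝ => x) (_root_.spectrum ℝ S) := continuousOn_id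
  have cidS : cfc (fun x : ℝ => x) S = S := cfc_id' ℝ S
  have cS : ∀ f : ℝ → ℝ, ContinuousOn f (_root_.spectrum ℝ S) →
      S * cfc f S = cfc (fun x => x * f x) S := fun f hf => by
    rw [cfc_mul _ _ S cid hf, cidS]
  have cS' : ∀ f : ℝ → ℝ, ContinuousOn f (_root_.spectrum ℝ S) →
      cfc f S * S = cfc (fun x => f x * x) S := fun f hf => by
    rw [cfc_mul _ _ S hf cid, cidS]
  have creal : ∀ (r : ℝ) (T : H →L[ℂ] H), r • T = (r : ℂ) • T := fun _ _ => rfl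
  have c1 : cfc (fun x : ℝ => 1 + ε * x) S = 1 + (ε : ℂ) • S := by
    rw [cfc_add (a := S) (fun _ => (1 : ℝ)) (fun x => ε * x) continuousOn_const (by fun_prop),
      cfc_const_one ℝ S, cfc_const_mul _ _ S cid, cidS, creal]
  have cc : cfc (fun x => 1 - χ x) S = 1 - cfc χ S := by
    rw [cfc_sub _ _ S continuousOn_const cχ, cfc_const_one ℝ S]
  refine ⟨cfc χ S, fun y => cfc (fun x : ℝ => χ x * if x = y then 1 else 0) S,
    cfc (fun x : ℝ => χ x * (x⁻¹ + ε)) S, cfc (fun x : ℝ => (1 - χ x) * (x / (1 + ε * x))) S,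
    ?_, ?_, ?_, ?_, ?_, ?_, ?_, ?_, ?_, ?_, ?_⟩
  · rw [← cfc_sum _ S F fun y _ => contχ _]
    refine cfc_congr fun x hx => ?_
    simp only [Finset.sum_apply, ← Finset.mul_sum, Finset.sum_ite_eq]
    rcases hσ hx with h | h
    · rw [if_pos (by exact_mod_cast h), mul_one]
    · rw [hχ0 x h, zero_mul]
  · intro y _
    rw [cS _ (contχ _), ← creal, ← cfc_const_mul _ _ S (contχ _)]
    refine cfc_congr fun x _ => ?_
    by_cases h : x = y <;> simp [h]
  · rw [cS _ cχ, cS' _ cχ]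
    simp only [mul_comm]
  · rw [← cfc_mul _ _ S cχ cχ]
    refine cfc_congr fun x _ => ?_
    by_cases h : x < -a <;> simp [χ, h]
  · exact cfc_predicate _ _
  · intro x hx v hv
    have hc : ContinuousOn (fun y => (1 - χ y) * (y - x)⁻¹) (_root_.spectrum ℝ S) := by
      refine cont (ContinuousOn.congr (f := fun y => (y - x)⁻¹) ?_ fun y hy => by simp [hχ0 y hy])
      refine ContinuousOn.inv₀ (by fun_prop) fun y hy => ?_
      have : -a ≤ y := hy
      linarith
    have h1 : cfc (fun y => (1 - χ y) * (y - x)⁻¹) S * (S - (x : ℂ) • 1) = 1 - cfc χ S := by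
      have h2 : cfc (fun y : ℝ => y - x) S = S - (x : ℂ) • 1 := by
        rw [cfc_sub _ _ S cid continuousOn_const, cidS, cfc_const x S]
        rfl
      rw [← h2, ← cc, ← cfc_mul _ _ S hc (by fun_prop)]
      refine cfc_congr fun y _ => ?_
      by_cases h : y < -a
      · simp [hχ1 h]
      · have : y - x ≠ 0 := by linarith
        simp [this]
    have h3 := congrArg (fun T : H →L[ℂ] H => T v) h1
    simp only [mul_apply_eq_comp, sub_apply,
      smul_apply, one_apply_eq_self, hv, sub_self, map_zero] at h3
    exact (sub_eq_zero.1 h3.symm).symm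
  · refine norm_cfc_le hε.le fun x _ => ?_
    by_cases h : x < -a
    · have hx : x < 0 := by linarith
      have h1 : -(2 * ε) < x⁻¹ := by
        have : (-a)⁻¹ < x⁻¹ := (inv_lt_inv_of_neg (by linarith) hx).2 h
        rwa [ha, inv_neg, inv_inv] at this
      have h2 : x⁻¹ < 0 := inv_lt_zero.2 hx
      rw [hχ1 h, one_mul, Real.norm_eq_abs, abs_le]
      constructor <;> linarith
    · simp [χ, h, hε.le]
  · rw [cS _ (contχ _), ← c1, ← cfc_mul _ _ S cχ (by fun_prop)]
    refine cfc_congr fun x _ => ?_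
    by_cases h : x < -a
    · have hx : x ≠ 0 := by linarith
      simp only [hχ1 h]
      field_simp
    · simp [χ, h]
  · refine norm_cfc_le (by positivity) fun x _ => ?_
    by_cases h : x < -a
    · simp [hχ1 h, hε.le]
    · rw [not_lt] at h
      have h1 : 1 / 2 ≤ 1 + ε * x := by nlinarith
      simp only [hχ0 x h, sub_zero, one_mul]
      rw [Real.norm_eq_abs, abs_div, abs_of_pos (by linarith : 0 < 1 + ε * x),
        div_le_iff₀ (by linarith), ← div_eq_inv_mul, le_div_iff₀ hε]
      rcases abs_cases x with ⟨h2, _⟩ | ⟨h2, _⟩ <;> rw [h2] <;> nlinarith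
  · have hc : ContinuousOn (fun x => (1 - χ x) * (x / (1 + ε * x))) (_root_.spectrum ℝ S) := by
      refine cont (ContinuousOn.congr (f := fun x => x / (1 + ε * x)) ?_
        fun y hy => by simp [hχ0 y hy])
      refine ContinuousOn.div₀ (by fun_prop) (by fun_prop) fun y hy => ?_
      have : -a ≤ y := hy
      nlinarith
    rw [← c1, ← cc, cS (fun x => 1 - χ x) (continuousOn_const.sub cχ),
      ← cfc_mul _ _ S hc (by fun_prop)]
    refine cfc_congr fun x _ => ?_
    by_cases h : x < -a
    · simp [hχ1 h]
    · have h1 : 1 + ε * x ≠ 0 := by nlinarith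
      rw [mul_assoc, div_mul_cancel₀ _ h1, mul_comm]
  · intro z hz
    -- for `‖z + ε‖ ≤ ε` a real `z⁻¹` is at most `-1/(2ε)`, but `S (1 - e)` has no spectrum there
    rw [← cc, cS (fun x => 1 - χ x) (continuousOn_const.sub cχ)]
    set S' := cfc (fun x => x * (1 - χ x)) S with hS'
    rcases eq_or_ne z 0 with rfl | hz0
    · simp
    have hsa : IsSelfAdjoint S' := cfc_predicate _ _
    have hnot : z⁻¹ ∉ _root_.spectrum ℂ S' := by
      intro hmem
      have hre := hsa.mem_spectrum_eq_re hmem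
      set t := (z⁻¹).re with ht
      have hzt : z = ((t⁻¹ : ℝ) : ℂ) := by rw [Complex.ofReal_inv, ← hre, inv_inv]
      have ht0 : t ≠ 0 := by
        rintro h
        rw [h] at hzt
        simp at hzt
        exact hz0 hzt
      have hmem' : t ∈ _root_.spectrum ℝ S' := by
        rw [← _root_.spectrum.algebraMap_mem_iff ℂ]
        rw [hre] at hmem
        exact hmem
      rw [hS', cfc_map_spectrum (fun x => x * (1 - χ x)) S hS
        (cid.mul (continuousOn_const.sub cχ))] at hmem'
      obtain ⟨x, hx, hxt⟩ := hmem'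
      -- spectral points to the left of the gap are sent to `0 ≠ t`
      have hxa : ¬ x < -a := fun h => ht0 (by rw [← hxt]; simp [hχ1 h])
      have hxe : x = t := by rw [← hxt]; simp [χ, hxa]
      have hxa' : -a < t := by
        rcases (not_lt.1 hxa).lt_or_eq with h | h
        · rwa [← hxe]
        · exact absurd (h ▸ hx) hgap
      rw [hzt, ← Complex.ofReal_add, Complex.norm_real, Real.norm_eq_abs, abs_le] at hz
      have htneg : t < 0 := by
        rcases lt_or_gt_of_ne ht0 with h | h
        · exact h
        · have := inv_pos.2 h
          linarith [hz.2]
      have : t⁻¹ < (-a)⁻¹ := (inv_lt_inv_of_neg htneg (by linarith)).2 hxa'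
      rw [ha, inv_neg, inv_inv] at this
      linarith [hz.1]
    rw [_root_.spectrum.notMem_iff] at hnot
    have h2 : 1 - z • S' = (algebraMap ℂ (H →L[ℂ] H) z) * (algebraMap ℂ _ z⁻¹ - S') := by
      rw [mul_sub, ← map_mul, mul_inv_cancel₀ hz0, map_one, ← Algebra.smul_def]
    rw [h2]
    exact ((IsUnit.mk0 z hz0).map _).mul hnot

end BoundedSpectral

/-! ### Resolvents and eigenspaces of real operators -/

section Resolvents

variable {𝕜 E : Type*} [RCLike 𝕜] [NormedAddCommGroup E] [InnerProductSpace 𝕜 E]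
  {T : E →ₗ.[𝕜] E} {μ ν : 𝕜} {S U : E →L[𝕜] E}

theorem IsResolventAt.injective (hS : IsResolventAt T μ S) : Function.Injective S := by
  refine (injective_iff_map_eq_zero S).2 fun y hy => ?_
  obtain ⟨h, h2⟩ := hS.1 y
  have : T ⟨S y, h⟩ = 0 := by
    have h3 : (⟨S y, h⟩ : T.domain) = 0 := Subtype.ext hy
    rw [h3, T.map_zero]
  rw [← h2, this, hy, smul_zero, sub_zero]

/-- The resolvent at `ν` maps an eigenvector for `s ≠ ν` to its multiple by `(s - ν)⁻¹`. -/
theorem IsResolventAt.apply_eigenvector (hS : IsResolventAt T ν S) {s : 𝕜} (hs : s ≠ ν) {v : E}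
    (hv : v ∈ T.domain) (hT : T ⟨v, hv⟩ = s • v) : S v = (s - ν)⁻¹ • v := by
  have h := hS.2 ⟨v, hv⟩
  rw [hT, ← sub_smul, map_smul] at h
  rw [eq_inv_smul_iff₀ (sub_ne_zero.2 hs)]
  exact h

theorem IsResolventAt.mem_domain_of_eigenvector (hS : IsResolventAt T μ S) {x : 𝕜} (hx : x ≠ 0)
    {v : E} (hv : S v = x • v) :
    ∃ h : v ∈ T.domain, T ⟨v, h⟩ = (μ + x⁻¹) • v := by
  have hv' : v = S (x⁻¹ • v) := by rw [map_smul, hv, inv_smul_smul₀ hx]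
  obtain ⟨h, h2⟩ := hS.1 (x⁻¹ • v)
  have hd : v ∈ T.domain := hv' ▸ h
  refine ⟨hd, ?_⟩
  have h3 : T ⟨v, hd⟩ = T ⟨S (x⁻¹ • v), h⟩ := congrArg T (Subtype.ext hv')
  rw [h3, add_smul, eq_add_of_sub_eq h2, ← hv', add_comm]

/-- The first resolvent identity, with the two orders of the product. -/
theorem IsResolventAt.resolvent_identity (hS : IsResolventAt T μ S) (hU : IsResolventAt T ν U) :
    U - S = (ν - μ) • (S * U) ∧ U - S = (ν - μ) • (U * S) := by
  constructor
  · ext y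
    obtain ⟨h, hy⟩ := hU.1 y
    have h2 := hS.2 ⟨U y, h⟩
    have h3 : T ⟨U y, h⟩ - μ • U y = y + (ν - μ) • U y := by
      nth_rewrite 3 [← hy]
      module
    simp only [h3, map_add, map_smul] at h2
    simp only [sub_apply, smul_apply, mul_apply_eq_comp]
    exact sub_eq_iff_eq_add'.2 h2.symm
  · ext y
    obtain ⟨h, hy⟩ := hS.1 y
    have h2 := hU.2 ⟨S y, h⟩
    have h3 : T ⟨S y, h⟩ - ν • S y = y - (ν - μ) • S y := by
      nth_rewrite 3 [← hy]
      module
    simp only [h3, map_sub, map_smul] at h2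
    simp only [sub_apply, smul_apply, mul_apply_eq_comp]
    exact sub_eq_iff_eq_add'.2 (sub_eq_iff_eq_add.1 h2)

theorem IsResolventAt.mul_one_sub (hS : IsResolventAt T μ S) (hU : IsResolventAt T ν U) :
    U * (1 - (ν - μ) • S) = S := by
  rw [mul_sub, mul_one, mul_smul_comm, ← (hS.resolvent_identity hU).2]
  abel

theorem IsResolventAt.isUnit_one_sub (hS : IsResolventAt T μ S) (hU : IsResolventAt T ν U) :
    IsUnit (1 - (ν - μ) • S) := by
  obtain ⟨h1, h2⟩ := hS.resolvent_identity hU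
  refine ⟨⟨1 - (ν - μ) • S, 1 + (ν - μ) • U, ?_, ?_⟩, rfl⟩
  · have h3 : (1 - (ν - μ) • S) * (1 + (ν - μ) • U)
        = 1 + (ν - μ) • (U - S - (ν - μ) • (S * U)) := by
      simp only [mul_add, sub_mul, one_mul, mul_one, smul_mul_smul_comm, smul_sub, smul_smul]
      abel
    rw [h3, ← h1, sub_self, smul_zero, add_zero]
  · have h3 : (1 + (ν - μ) • U) * (1 - (ν - μ) • S)
        = 1 + (ν - μ) • (U - S - (ν - μ) • (U * S)) := by
      simp only [mul_sub, add_mul, one_mul, mul_one, smul_mul_smul_comm, smul_sub, smul_smul]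
      abel
    rw [h3, ← h2, sub_self, smul_zero, add_zero]

theorem IsResolventAt.of_isUnit (hS : IsResolventAt T μ S) (h : IsUnit (1 - (ν - μ) • S)) :
    ∃ U, IsResolventAt T ν U := by
  obtain ⟨⟨u, w, huw, hwu⟩, rfl : u = _⟩ := h
  refine ⟨S * w, fun y => ?_, fun x => ?_⟩
  · obtain ⟨h, hy⟩ := hS.1 (w y)
    refine ⟨h, ?_⟩
    have h2 := congrArg (fun V : E →L[𝕜] E => V y) huw
    simp only [mul_apply_eq_comp, sub_apply, smul_apply, one_apply_eq_self] at h2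
    calc T ⟨S (w y), h⟩ - ν • S (w y) = w y - (ν - μ) • S (w y) := by
          rw [eq_add_of_sub_eq hy]
          module
      _ = y := h2
  · have h2 := hS.2 x
    have h3 := congrArg (fun V : E →L[𝕜] E => V (T x - μ • (x : E))) hwu
    simp only [mul_apply_eq_comp, sub_apply, smul_apply, one_apply_eq_self, h2] at h3
    have h4 : T x - ν • (x : E) = T x - μ • (x : E) - (ν - μ) • (x : E) := by module
    rw [mul_apply_eq_comp, h4, h3, h2]

end Resolvents

section RealOperators

variable {X : Type*} [NormedAddCommGroup X] [InnerProductSpace ℝ X] {T : X →ₗ.[ℝ] X}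

theorem isResolventAt_resolvent {μ : ℂ} (h : μ ∈ resolventSet T) :
    IsResolventAt (complexify T) μ (resolvent T μ) := by
  rw [resolvent, dif_pos h]
  exact h.choose_spec

theorem mem_eigenspace_iff {s : ℝ} {x : X} :
    x ∈ eigenspace T s ↔ ∃ h : x ∈ T.domain, T ⟨x, h⟩ = s • x := by
  simp only [eigenspace, Submodule.mem_map, LinearMap.mem_ker, LinearMap.sub_apply,
    LinearMap.smul_apply, Submodule.subtype_apply, sub_eq_zero]
  constructor
  · rintro ⟨y, hy, rfl⟩
    exact ⟨y.2, hy⟩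
  · rintro ⟨h, hx⟩
    exact ⟨⟨x, h⟩, hx, rfl⟩

theorem complexify_eq_smul_iff {s : ℝ} {z : Complexification X} :
    (∃ h : z ∈ (complexify T).domain, complexify T ⟨z, h⟩ = (s : ℂ) • z) ↔
      z.re ∈ eigenspace T s ∧ z.im ∈ eigenspace T s := by
  simp only [mem_eigenspace_iff]
  constructor
  · rintro ⟨h, hz⟩
    have h1 := congrArg Complexification.re hz
    have h2 := congrArg Complexification.im hz
    simp only [Complexification.re_smul, Complexification.im_smul, Complex.ofReal_re,
      Complex.ofReal_im, zero_smul, sub_zero, add_zero] at h1 h2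
    exact ⟨⟨h.1, h1⟩, ⟨h.2, h2⟩⟩
  · rintro ⟨⟨h1, h1'⟩, ⟨h2, h2'⟩⟩
    refine ⟨⟨h1, h2⟩, Complexification.ext ?_ ?_⟩
    · simp only [Complexification.re_smul, Complex.ofReal_re, Complex.ofReal_im, zero_smul,
        sub_zero]
      exact h1'
    · simp only [Complexification.im_smul, Complex.ofReal_re, Complex.ofReal_im, zero_smul,
        add_zero]
      exact h2'

theorem eigenspace_eq_bot_of_mem_resolventSet {s : ℝ} (h : (s : ℂ) ∈ resolventSet T) :
    eigenspace T s = ⊥ := by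
  refine (Submodule.eq_bot_iff _).2 fun x hx => ?_
  obtain ⟨S, hS⟩ := h
  have hz : (Complexification.mk x 0).re ∈ eigenspace T s ∧
      (Complexification.mk x 0).im ∈ eigenspace T s := ⟨hx, Submodule.zero_mem _⟩
  obtain ⟨h1, h2⟩ := complexify_eq_smul_iff.2 hz
  have h3 := hS.2 ⟨_, h1⟩
  rw [h2, sub_self, map_zero] at h3
  exact (congrArg Complexification.re h3).symm

variable [CompleteSpace X]

theorem inner_map_eq_of_isSelfAdjoint (hT : IsSelfAdjoint T) (x y : T.domain) :
    inner ℝ (T x) (y : X) = inner ℝ (x : X) (T y) := by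
  have h := LinearPMap.adjoint_isFormalAdjoint hT.dense_domain
  rw [LinearPMap.isSelfAdjoint_def.1 hT] at h
  exact h x y

theorem inner_complexify_eq_of_isSelfAdjoint (hT : IsSelfAdjoint T)
    (x y : (complexify T).domain) :
    inner ℂ (complexify T x) (y : Complexification X) =
      inner ℂ (x : Complexification X) (complexify T y) := by
  have h := inner_map_eq_of_isSelfAdjoint hT
  have h1 := h ⟨_, x.2.1⟩ ⟨_, y.2.1⟩
  have h2 := h ⟨_, x.2.1⟩ ⟨_, y.2.2⟩
  have h3 := h ⟨_, x.2.2⟩ ⟨_, y.2.1⟩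
  have h4 := h ⟨_, x.2.2⟩ ⟨_, y.2.2⟩
  exact Complex.ext (congrArg₂ (· + ·) h1 h4) (congrArg₂ (· - ·) h2 h3)

theorem isSelfAdjoint_of_isResolventAt (hT : IsSelfAdjoint T) {r : ℝ}
    {S : Complexification X →L[ℂ] Complexification X}
    (hS : IsResolventAt (complexify T) (r : ℂ) S) : IsSelfAdjoint S := by
  refine LinearMap.IsSymmetric.isSelfAdjoint fun x y => ?_
  obtain ⟨hx, hx'⟩ := hS.1 x
  obtain ⟨hy, hy'⟩ := hS.1 y
  have h := inner_complexify_eq_of_isSelfAdjoint hT ⟨_, hx⟩ ⟨_, hy⟩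
  change inner ℂ (S x) y = inner ℂ x (S y)
  nth_rewrite 1 [← hy']
  nth_rewrite 2 [← hx']
  rw [inner_sub_left, inner_sub_right, h, inner_smul_left, inner_smul_right, Complex.conj_ofReal]

end RealOperators

/-! ### Riesz projections of self-adjoint operators -/

section Window

variable {X : Type*} [NormedAddCommGroup X] [InnerProductSpace ℝ X] {T : X →ₗ.[ℝ] X}

/-- The sum of the eigenspaces of `T` for the eigenvalues in the interval `(l - ε, l + ε)`. -/
noncomputable def windowSpace (T : X →ₗ.[ℝ] X) (l ε : ℝ) : Submodule ℝ X :=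
  ⨆ s : Metric.ball l ε, eigenspace T s

theorem windowSpace_le_domain (T : X →ₗ.[ℝ] X) (l ε : ℝ) : windowSpace T l ε ≤ T.domain :=
  iSup_le fun _ _ hx => (mem_eigenspace_iff.1 hx).1

theorem windowSpace_le_iSup_spectrum {δ l ε : ℝ} (hlε : l + ε ≤ δ) :
    windowSpace T l ε ≤ ⨆ s : {s : ℝ | s < δ ∧ (s : ℂ) ∈ spectrum T}, eigenspace T s := by
  refine iSup_le fun s => ?_
  have hs : |(s : ℝ) - l| < ε := s.2
  by_cases h : ((s : ℝ) : ℂ) ∈ resolventSet T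
  · rw [eigenspace_eq_bot_of_mem_resolventSet h]
    exact bot_le
  · exact le_iSup (fun s : {s : ℝ | s < δ ∧ (s : ℂ) ∈ spectrum T} => eigenspace T s)
      ⟨s, by linarith [(abs_lt.1 hs).2], h⟩

theorem finiteDimensional_windowSpace {δ l ε : ℝ} (hfin : FiniteSpectrumBelow T δ)
    (hlε : l + ε ≤ δ) : FiniteDimensional ℝ (windowSpace T l ε) := by
  have := hfin.1.to_subtype
  have : ∀ s : {s : ℝ | s < δ ∧ (s : ℂ) ∈ spectrum T}, FiniteDimensional ℝ (eigenspace T s) :=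
    fun s => (hfin.2 s s.2.1 s.2.2).2
  exact Submodule.finiteDimensional_of_le (windowSpace_le_iSup_spectrum hlε)

/-- If `V` is a complex subspace with `z ∈ V` iff both parts of `z` lie in the finite-dimensional
real subspace `W`, then `V` is the complexification of `W` and has the same dimension. -/
theorem finrank_eq_of_mem_iff {V : Submodule ℂ (Complexification X)} {W : Submodule ℝ X}
    [FiniteDimensional ℝ W] (h : ∀ z, z ∈ V ↔ z.re ∈ W ∧ z.im ∈ W) :
    FiniteDimensional ℂ V ∧ Module.finrank ℂ V = Module.finrank ℝ W := by
  let f : V ≃ₗ[ℝ] W × W :=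
    { toFun := fun z => (⟨_, ((h z).1 z.2).1⟩, ⟨_, ((h z).1 z.2).2⟩)
      map_add' := fun z w => rfl
      map_smul' := fun c z => by
        refine Prod.ext (Subtype.ext ?_) (Subtype.ext ?_)
        · change ((c : ℂ) • (z : Complexification X)).re = c • (z : Complexification X).re
          rw [Complexification.re_smul, Complex.ofReal_re, Complex.ofReal_im, zero_smul, sub_zero]
        · change ((c : ℂ) • (z : Complexification X)).im = c • (z : Complexification X).im
          rw [Complexification.im_smul, Complex.ofReal_re, Complex.ofReal_im, zero_smul, add_zero]
      invFun := fun p => ⟨Complexification.mk p.1 p.2, (h _).2 ⟨p.1.2, p.2.2⟩⟩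
      left_inv := fun z => rfl
      right_inv := fun p => rfl }
  have h1 : FiniteDimensional ℝ V := f.symm.finiteDimensional
  have h2 := f.finrank_eq
  rw [finrank_real_of_complex, Module.finrank_prod] at h2
  exact ⟨Module.Finite.right ℝ ℂ V, by omega⟩

/-- The resolvent `S` of `T` at `l + ε` satisfies the hypotheses of `exists_spectral_splitting`: the
spectrum of `T` below `δ` is finite, and `l - ε ∈ ρ(T)` is the gap. -/
theorem spectrum_subset_of_isResolventAt {l ε δ : ℝ} (hε : 0 < ε) (hlε : l + ε < δ)
    (hfin : FiniteSpectrumBelow T δ) (hleft : ((l - ε : ℝ) : ℂ) ∈ resolventSet T)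
    {S : Complexification X →L[ℂ] Complexification X}
    (hS : IsResolventAt (complexify T) ((l + ε : ℝ) : ℂ) S) :
    (∃ F : Finset ℝ, (∀ x ∈ F, x < -(2 * ε)⁻¹) ∧
      _root_.spectrum ℝ S ⊆ ↑F ∪ Set.Ici (-(2 * ε)⁻¹)) ∧
    -(2 * ε)⁻¹ ∉ _root_.spectrum ℝ S := by
  -- a nonzero spectral point `x` of `S` is `(s - (l + ε))⁻¹` with `s` in the spectrum of `T`
  have key : ∀ x : ℝ, x ≠ 0 → x ∈ _root_.spectrum ℝ S →
      ((l + ε + x⁻¹ : ℝ) : ℂ) ∉ resolventSet T := by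
    rintro x hx0 hx ⟨U, hU⟩
    have h1 := hS.isUnit_one_sub hU
    rw [_root_.spectrum.mem_iff] at hx
    refine hx ?_
    have hxc : (x : ℂ) ≠ 0 := by exact_mod_cast hx0
    have h2 : algebraMap ℝ (Complexification X →L[ℂ] Complexification X) x - S =
        algebraMap ℂ _ (x : ℂ) *
          (1 - (((l + ε + x⁻¹ : ℝ) : ℂ) - ((l + ε : ℝ) : ℂ)) • S) := by
      rw [← Algebra.smul_def, smul_sub, smul_smul]
      have : (x : ℂ) * (((l + ε + x⁻¹ : ℝ) : ℂ) - ((l + ε : ℝ) : ℂ)) = 1 := by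
        push_cast
        field_simp
        ring
      rw [this, one_smul]
      rfl
    rw [h2]
    exact ((IsUnit.mk0 _ hxc).map _).mul h1
  have ha : 0 < (2 * ε)⁻¹ := by positivity
  refine ⟨⟨(hfin.1.toFinset.image fun s => (s - (l + ε))⁻¹).filter (· < -(2 * ε)⁻¹),
    fun x hx => (Finset.mem_filter.1 hx).2, fun x hx => ?_⟩, fun hx => ?_⟩
  · by_cases h : x < -(2 * ε)⁻¹
    · left
      have hx0 : x < 0 := by linarith
      have hxi : x⁻¹ < 0 := inv_lt_zero.2 hx0
      simp only [Finset.coe_filter, Finset.mem_image, Set.Finite.mem_toFinset, Set.mem_ofPred_eq]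
      exact ⟨⟨l + ε + x⁻¹, ⟨by linarith, key x hx0.ne hx⟩, by simp⟩, h⟩
    · exact Or.inr (not_lt.1 h)
  · refine key _ (by linarith) hx ?_
    rw [inv_neg, inv_inv]
    convert hleft using 2
    ring

variable [CompleteSpace X]

/-- The circle about `l` through `l ± ε ∈ ρ(T)` lies in `ρ(T)`, since the resolvent at `l + ε` is
self-adjoint and so has no non-real spectrum. -/
theorem sphere_subset_resolventSet (hT : IsSelfAdjoint T) {l ε : ℝ}
    (hright : ((l + ε : ℝ) : ℂ) ∈ resolventSet T) (hleft : ((l - ε : ℝ) : ℂ) ∈ resolventSet T) :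
    Metric.sphere (l : ℂ) ε ⊆ resolventSet T := by
  intro μ hμ
  obtain ⟨S, hS⟩ := hright
  have hsa := isSelfAdjoint_of_isResolventAt hT hS
  by_cases him : μ.im = 0
  · have hμr : μ = (μ.re : ℂ) := Complex.ext rfl (by simp [him])
    have hε : 0 ≤ ε := by rw [← mem_sphere_iff_norm.1 hμ]; exact norm_nonneg _
    rw [hμr, mem_sphere_iff_norm, ← Complex.ofReal_sub, Complex.norm_real, Real.norm_eq_abs,
      abs_eq hε] at hμ
    rcases hμ with h | h
    · have : μ = ((l + ε : ℝ) : ℂ) := by rw [hμr]; congr 1; linarith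
      exact ⟨S, this ▸ hS⟩
    · have : μ = ((l - ε : ℝ) : ℂ) := by rw [hμr]; congr 1; linarith
      exact this ▸ hleft
  · refine hS.of_isUnit ?_
    set z := μ - ((l + ε : ℝ) : ℂ) with hz
    have hzim : z.im ≠ 0 := by simpa [hz] using him
    have hz0 : z ≠ 0 := fun h => hzim (by rw [h]; rfl)
    have hnot : z⁻¹ ∉ _root_.spectrum ℂ S := fun h => by
      have h1 := congrArg Complex.im (hsa.mem_spectrum_eq_re h)
      rw [Complex.ofReal_im, Complex.inv_im, div_eq_zero_iff] at h1
      rcases h1 with h1 | h1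
      · exact hzim (neg_eq_zero.1 h1)
      · exact hz0 (Complex.normSq_eq_zero.1 h1)
    rw [_root_.spectrum.notMem_iff] at hnot
    have h2 : 1 - z • S = (algebraMap ℂ _ z) * (algebraMap ℂ _ z⁻¹ - S) := by
      rw [mul_sub, ← map_mul, mul_inv_cancel₀ hz0, map_one, ← Algebra.smul_def]
    rw [h2]
    exact ((IsUnit.mk0 z hz0).map _).mul hnot

/-- The Riesz projection is the spectral projection `e`: on the range of each `E x` the resolvent
is a scalar with a simple pole inside the circle, and on the range of `1 - e` it extends
holomorphically to the disc. -/
theorem rieszProjection_eq_of_splitting {l ε : ℝ} (hε : 0 < ε)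
    {S : Complexification X →L[ℂ] Complexification X}
    (hS : IsResolventAt (complexify T) ((l + ε : ℝ) : ℂ) S)
    (hsphere : Metric.sphere (l : ℂ) ε ⊆ resolventSet T)
    {e : Complexification X →L[ℂ] Complexification X}
    {E : ℝ → Complexification X →L[ℂ] Complexification X} {F : Finset ℝ}
    (hF : ∀ x ∈ F, x < -(2 * ε)⁻¹) (heE : e = ∑ x ∈ F, E x)
    (hE : ∀ x ∈ F, S * E x = (x : ℂ) • E x) (hSe : S * e = e * S) (hee : e * e = e)
    (hunit : ∀ z : ℂ, ‖z + ε‖ ≤ ε → IsUnit (1 - z • (S * (1 - e)))) :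
    rieszProjection T l ε = e := by
  set S' := S * (1 - e) with hS'
  set m : ℂ := ((l + ε : ℝ) : ℂ) with hm
  let P : ℂ → Complexification X →L[ℂ] Complexification X :=
    fun μ => S' * Ring.inverse (1 - (μ - m) • S')
  have hball : ∀ x ∈ F, (((l + ε + x⁻¹ : ℝ)) : ℂ) ∈ Metric.ball (l : ℂ) ε := by
    intro x hx
    have h1 := hF x hx
    have ha : 0 < (2 * ε)⁻¹ := by positivity
    have hx0 : x < 0 := by linarith
    have hxi : x⁻¹ < 0 := inv_lt_zero.2 hx0
    have h2 : (-(2 * ε)⁻¹)⁻¹ < x⁻¹ := (inv_lt_inv_of_neg (by linarith) hx0).2 h1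
    rw [inv_neg, inv_inv] at h2
    rw [mem_ball_iff_norm, ← Complex.ofReal_sub, Complex.norm_real, Real.norm_eq_abs, abs_lt]
    constructor <;> linarith
  have hdisc : ∀ μ ∈ Metric.closedBall (l : ℂ) ε, IsUnit (1 - (μ - m) • S') := by
    intro μ hμ
    refine hunit _ ?_
    have : μ - m + ε = μ - l := by rw [hm]; push_cast; ring
    rw [this]
    exact mem_closedBall_iff_norm.1 hμ
  have hPd : ∀ μ ∈ Metric.closedBall (l : ℂ) ε, DifferentiableAt ℂ P μ := by
    intro μ hμ
    have h1 : DifferentiableAt ℂ (fun μ : ℂ => 1 - (μ - m) • S') μ := by fun_prop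
    have h2 := (differentiableAt_inverse (𝕜 := ℂ) (hdisc μ hμ)).comp μ h1
    exact h2.const_mul S'
  -- the resolvent on the circle
  have hres : ∀ μ ∈ Metric.sphere (l : ℂ) ε,
      -resolvent T μ = (∑ x ∈ F, (μ - ((l + ε + x⁻¹ : ℝ) : ℂ))⁻¹ • E x) - P μ := by
    intro μ hμ
    have hR := isResolventAt_resolvent (hsphere hμ)
    set R := resolvent T μ
    have h1 : R * (1 - e) = P μ := by
      have hcomm : (1 - e) * (1 - (μ - m) • S') = (1 - (μ - m) • S) * (1 - e) := by
        have h3 : (1 - e) * S' = S * (1 - e) := by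
          rw [hS']
          simp only [mul_sub, sub_mul, mul_one, one_mul, hSe, ← mul_assoc, hee]
          abel
        rw [mul_sub (1 - e) 1, mul_smul_comm, h3, sub_mul 1 ((μ - m) • S), smul_mul_assoc, one_mul,
          mul_one]
      have h4 : R * (1 - e) * (1 - (μ - m) • S') = S' := by
        rw [mul_assoc, hcomm, ← mul_assoc, hS.mul_one_sub hR]
      have h5 := hdisc μ (Metric.sphere_subset_closedBall hμ)
      calc R * (1 - e)
          = R * (1 - e) * ((1 - (μ - m) • S') * Ring.inverse (1 - (μ - m) • S')) := by
            rw [Ring.mul_inverse_cancel _ h5, mul_one]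
        _ = P μ := by rw [← mul_assoc, h4]
    have h2 : ∀ x ∈ F, R * E x = -((μ - ((l + ε + x⁻¹ : ℝ) : ℂ))⁻¹ • E x) := by
      intro x hx
      ext1 y
      have hx0 : (x : ℂ) ≠ 0 := by
        have : 0 < (2 * ε)⁻¹ := by positivity
        have := hF x hx
        exact_mod_cast (by linarith : x ≠ 0)
      have h3 : S (E x y) = (x : ℂ) • E x y := congrArg (fun V => V y) (hE x hx)
      obtain ⟨h4, h5⟩ := hS.mem_domain_of_eigenvector hx0 h3
      have hne : m + (x : ℂ)⁻¹ ≠ μ := by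
        intro h
        have h6 := hball x hx
        have h7 : (((l + ε + x⁻¹ : ℝ)) : ℂ) = μ := by rw [← h, hm]; push_cast; ring
        rw [h7, Metric.mem_ball, Metric.mem_sphere.1 hμ] at h6
        exact lt_irrefl _ h6
      have h6 := hR.apply_eigenvector hne h4 h5
      have h7 : (μ - ((l + ε + x⁻¹ : ℝ) : ℂ)) = -(m + (x : ℂ)⁻¹ - μ) := by
        rw [hm]; push_cast; ring
      rw [h7, inv_neg, neg_smul, neg_neg]
      exact h6
    have h3 : R = R * (1 - e) + ∑ x ∈ F, R * E x := by
      rw [← Finset.mul_sum, ← heE, ← mul_add, sub_add_cancel, mul_one]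
    rw [h3, h1, Finset.sum_congr rfl h2, Finset.sum_neg_distrib]
    abel
  have hci : ∀ x ∈ F, CircleIntegrable
      (fun μ : ℂ => (μ - ((l + ε + x⁻¹ : ℝ) : ℂ))⁻¹ • E x) l ε := by
    intro x hx
    refine ContinuousOn.circleIntegrable hε.le
      (ContinuousOn.smul (ContinuousOn.inv₀
        (f := fun μ : ℂ => μ - ((l + ε + x⁻¹ : ℝ) : ℂ)) (by fun_prop) fun μ hμ h => ?_)
        continuousOn_const)
    have h6 := hball x hx
    rw [← sub_eq_zero.1 h, Metric.mem_ball, Metric.mem_sphere.1 hμ] at h6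
    exact lt_irrefl _ h6
  have hP0 : ∮ μ in C((l : ℂ), ε), P μ = 0 := by
    refine DiffContOnCl.circleIntegral_eq_zero hε.le ⟨fun μ hμ =>
      (hPd μ (Metric.ball_subset_closedBall hμ)).differentiableWithinAt, ?_⟩
    rw [closure_ball _ hε.ne']
    exact fun μ hμ => (hPd μ hμ).continuousAt.continuousWithinAt
  have hPi : CircleIntegrable P l ε := ContinuousOn.circleIntegrable hε.le fun μ hμ =>
    (hPd μ (Metric.sphere_subset_closedBall hμ)).continuousAt.continuousWithinAt
  have hsum : CircleIntegrable
      (fun μ : ℂ => ∑ x ∈ F, (μ - ((l + ε + x⁻¹ : ℝ) : ℂ))⁻¹ • E x) l ε := by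
    have := CircleIntegrable.sum F hci
    convert this using 1
    ext1 μ
    simp
  have hpi : (2 * Real.pi * Complex.I : ℂ) ≠ 0 := by
    simp [Real.pi_ne_zero]
  rw [rieszProjection, circleIntegral.integral_congr hε.le hres,
    circleIntegral.integral_sub hsum hPi, hP0, sub_zero, circleIntegral.integral_fun_sum hci,
    Finset.sum_congr rfl fun x hx => by
      rw [circleIntegral.integral_smul_const, circleIntegral.integral_sub_inv_of_mem_ball
        (hball x hx)],
    ← Finset.smul_sum, smul_smul, inv_mul_cancel₀ hpi, one_smul, heE]

end Window

/-! ### Estimates on the spectral subspace and its complement -/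

section WindowEstimates

variable {X : Type*} [NormedAddCommGroup X]

theorem norm_mk_zero (x : X) : ‖Complexification.mk x (0 : X)‖ = ‖x‖ := by
  have h := Complexification.norm_sq_eq (Complexification.mk x (0 : X))
  rw [Complexification.re_mk, Complexification.im_mk, norm_zero] at h
  exact (sq_eq_sq₀ (norm_nonneg _) (norm_nonneg _)).1 (by rw [h]; ring)

theorem mk_zero_add (x y : X) : Complexification.mk (x + y) (0 : X) =
    Complexification.mk x 0 + Complexification.mk y 0 :=
  Complexification.ext rfl (add_zero 0).symm

variable [InnerProductSpace ℝ X] {T : X →ₗ.[ℝ] X}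

theorem eq_mk_re_add_smul_mk_im (z : Complexification X) :
    z = Complexification.mk z.re 0 + Complex.I • Complexification.mk z.im 0 :=
  Complexification.ext (by simp) (by simp)

theorem complexify_mk_zero (v : T.domain) :
    ∃ h : Complexification.mk (v : X) 0 ∈ (complexify T).domain,
      complexify T ⟨_, h⟩ = Complexification.mk (T v) 0 :=
  ⟨⟨v.2, T.domain.zero_mem⟩, Complexification.ext rfl T.map_zero⟩

variable [CompleteSpace X]

/-- The spectral theorem below the threshold `δ`: the range of the Riesz projection is the
complexification of the sum `W` of the eigenspaces inside the circle, and `T - l` is bounded by `ε`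
on `W` and bounded below by `ε` on the orthogonal complement of `W`. -/
theorem finrank_rieszRange_and_estimates (hT : IsSelfAdjoint T) {l ε δ : ℝ} (hε : 0 < ε)
    (hlε : l + ε < δ) (hfin : FiniteSpectrumBelow T δ)
    (hright : ((l + ε : ℝ) : ℂ) ∈ resolventSet T) (hleft : ((l - ε : ℝ) : ℂ) ∈ resolventSet T) :
    (FiniteDimensional ℂ (rieszRange T l ε) ∧
      Module.finrank ℂ (rieszRange T l ε) = Module.finrank ℝ (windowSpace T l ε)) ∧
    (∀ v : T.domain, (v : X) ∈ windowSpace T l ε → ‖T v - l • (v : X)‖ ≤ ε * ‖(v : X)‖) ∧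
    (∀ v : T.domain, (v : X) ∈ (windowSpace T l ε)ᗮ → ε * ‖(v : X)‖ ≤ ‖T v - l • (v : X)‖) := by
  have hsphere := sphere_subset_resolventSet hT hright hleft
  obtain ⟨S, hS⟩ := hright
  have hsa := isSelfAdjoint_of_isResolventAt hT hS
  obtain ⟨⟨F, hF, hσ⟩, hgap⟩ := spectrum_subset_of_isResolventAt hε hlε hfin hleft hS
  obtain ⟨e, E, D, Q, heE, hE, hSe, hee, hesa, heig, hD, hSD, hQ, hQS, hunit⟩ :=
    exists_spectral_splitting hsa hε hσ hgap
  have hP := rieszProjection_eq_of_splitting hε hS hsphere hF heE hE hSe hee hunit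
  set W := windowSpace T l ε with hW
  have hWfd : FiniteDimensional ℝ W := finiteDimensional_windowSpace hfin hlε.le
  have ha : 0 < (2 * ε)⁻¹ := by positivity
  -- the range of `e` is contained in the complexification of `W`
  have hrange : ∀ z, (e z).re ∈ W ∧ (e z).im ∈ W := by
    intro z
    rw [heE, sum_apply]
    refine Finset.sum_induction _ (fun y : Complexification X => y.re ∈ W ∧ y.im ∈ W)
      (fun y y' h h' => ⟨W.add_mem h.1 h'.1, W.add_mem h.2 h'.2⟩) ⟨W.zero_mem, W.zero_mem⟩ ?_
    intro x hx
    have hxa := hF x hx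
    have hx0 : x < 0 := by linarith
    have hxc : (x : ℂ) ≠ 0 := by exact_mod_cast hx0.ne
    have h3 : S (E x z) = (x : ℂ) • E x z := congrArg (fun V => V z) (hE x hx)
    obtain ⟨h4, h5⟩ := hS.mem_domain_of_eigenvector hxc h3
    have h6 : ((l + ε : ℝ) : ℂ) + (x : ℂ)⁻¹ = ((l + ε + x⁻¹ : ℝ) : ℂ) := by push_cast; ring
    rw [h6] at h5
    have h7 := complexify_eq_smul_iff.1 ⟨h4, h5⟩
    have hxi : x⁻¹ < 0 := inv_lt_zero.2 hx0
    have h2 : (-(2 * ε)⁻¹)⁻¹ < x⁻¹ := (inv_lt_inv_of_neg (by linarith) hx0).2 hxa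
    rw [inv_neg, inv_inv] at h2
    have hmem : l + ε + x⁻¹ ∈ Metric.ball l ε := by
      rw [mem_ball_iff_norm, Real.norm_eq_abs, abs_lt]
      constructor <;> linarith
    have hle : eigenspace T (l + ε + x⁻¹) ≤ W :=
      le_iSup (fun s : Metric.ball l ε => eigenspace T s) ⟨_, hmem⟩
    exact ⟨hle h7.1, hle h7.2⟩
  -- `e` is the identity on the complexification of `W`
  have hfix : ∀ x ∈ W, e (Complexification.mk x 0) = Complexification.mk x 0 := by
    intro x hx
    refine Submodule.iSup_induction _ (motive := fun x => e (Complexification.mk x 0) =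
      Complexification.mk x 0) hx (fun s x hx => ?_) (map_zero e) (fun x y h h' => ?_)
    · have hs : |(s : ℝ) - l| < ε := s.2
      obtain ⟨hs1, hs2⟩ := abs_lt.1 hs
      have hz : (Complexification.mk x 0).re ∈ eigenspace T s ∧
        (Complexification.mk x 0).im ∈ eigenspace T s := ⟨hx, Submodule.zero_mem _⟩
      obtain ⟨h1, h2⟩ := complexify_eq_smul_iff.2 hz
      have hne : ((s : ℝ) : ℂ) ≠ ((l + ε : ℝ) : ℂ) := by
        intro h
        have : (s : ℝ) = l + ε := by exact_mod_cast h
        linarith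
      refine heig ((s : ℝ) - (l + ε))⁻¹ ?_ _ ?_
      · rw [← inv_neg]
        exact (inv_lt_inv_of_neg (by linarith) (by linarith)).2 (by linarith)
      · rw [hS.apply_eigenvector hne h1 h2]
        push_cast
        rfl
    · rw [mk_zero_add, map_add, h, h']
  have hmemiff : ∀ z, z ∈ rieszRange T l ε ↔ z.re ∈ W ∧ z.im ∈ W := by
    intro z
    rw [rieszRange, hP]
    constructor
    · rintro ⟨y, rfl⟩
      exact hrange y
    · rintro ⟨h1, h2⟩
      refine ⟨z, ?_⟩
      change e z = z
      rw [eq_mk_re_add_smul_mk_im z, map_add, map_smul, hfix _ h1, hfix _ h2]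
  refine ⟨finrank_eq_of_mem_iff hmemiff, fun v hv => ?_, fun v hv => ?_⟩
  all_goals
    obtain ⟨hd, hTv⟩ := complexify_mk_zero v
    set z := Complexification.mk (v : X) 0 with hz
    set u := complexify T ⟨z, hd⟩ - ((l + ε : ℝ) : ℂ) • z with hu
    have hSu : S u = z := hS.2 ⟨z, hd⟩
    have hw : Complexification.mk (T v - l • (v : X)) 0 = u + (ε : ℂ) • z := by
      rw [hu, hTv, hz]
      refine Complexification.ext ?_ ?_
      · change T v - l • (v : X) = T v - ((l + ε) • (v : X) - (0 : ℝ) • (0 : X)) +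
          (ε • (v : X) - (0 : ℝ) • (0 : X))
        module
      · change (0 : X) = 0 - ((l + ε) • (0 : X) + (0 : ℝ) • (v : X)) +
          (ε • (0 : X) + (0 : ℝ) • (v : X))
        module
    rw [← norm_mk_zero (T v - l • (v : X)), ← norm_mk_zero (v : X), hw]
  · have hez : e z = z := hfix _ hv
    have h1 : D z = u + (ε : ℂ) • z := by
      apply hS.injective
      have h2 := congrArg (fun V => V z) hSD
      have h3 := congrArg (fun V => V z) hSe
      simp only [mul_apply_eq_comp, add_apply, smul_apply, one_apply_eq_self, map_add,
        map_smul] at h2 h3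
      rw [h2, ← h3, hez, map_add, map_smul, hSu]
    rw [← h1]
    exact (D.le_opNorm z).trans (by gcongr)
  · have hez : e z = 0 := by
      rw [← inner_self_eq_zero (𝕜 := ℂ)]
      have h1 : inner ℂ (e z) (e z) = inner ℂ z (e z) := by
        have h2 := congrArg (fun V => V z) hee
        rw [mul_apply_eq_comp] at h2
        have h3 := (ContinuousLinearMap.isSelfAdjoint_iff_isSymmetric.1 hesa) z (e z)
        change inner ℂ (e z) (e z) = inner ℂ z (e (e z)) at h3
        rw [h3, h2]
      rw [h1]
      obtain ⟨h2, h3⟩ := hrange z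
      have h4 := Submodule.inner_left_of_mem_orthogonal h2 hv
      have h5 := Submodule.inner_left_of_mem_orthogonal h3 hv
      refine Complex.ext ?_ ?_
      · change inner ℝ (v : X) (e z).re + inner ℝ (0 : X) (e z).im = 0
        rw [h4, inner_zero_left, add_zero]
      · change inner ℝ (v : X) (e z).im - inner ℝ (0 : X) (e z).re = 0
        rw [h5, inner_zero_left, sub_zero]
    have h1 : Q (u + (ε : ℂ) • z) = z := by
      have h2 := congrArg (fun V => V u) hQS
      have h3 := congrArg (fun V => V u) hSe
      simp only [mul_apply_eq_comp, add_apply, sub_apply, smul_apply, one_apply_eq_self, map_sub,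
        hSu, hez] at h2 h3
      rw [h2, h3, sub_zero]
    have h2 := (Q.le_opNorm (u + (ε : ℂ) • z)).trans
      (mul_le_mul_of_nonneg_right hQ (norm_nonneg _))
    rwa [h1, ← div_eq_inv_mul, le_div_iff₀ hε, mul_comm] at h2

end WindowEstimates

/-! ### Weak limits and the reduced operators -/

section WeakLimits

variable {X : Type*} [NormedAddCommGroup X] [InnerProductSpace ℝ X] {ι : Type*}

/-- Weak convergence of the family `f` to `g` along the filter `F`, tested by inner products. -/
def WeakTendsto (f : ι → X) (F : Filter ι) (g : X) : Prop :=
  ∀ y : X, Tendsto (fun n => inner ℝ y (f n)) F (𝓝 (inner ℝ y g))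

namespace WeakTendsto

variable {f f' : ι → X} {F : Filter ι} {g g' : X}

theorem of_tendsto (h : Tendsto f F (𝓝 g)) : WeakTendsto f F g := fun _ =>
  tendsto_const_nhds.inner h

theorem unique [F.NeBot] (h : WeakTendsto f F g) (h' : WeakTendsto f F g') : g = g' :=
  ext_inner_left ℝ fun y => tendsto_nhds_unique (h y) (h' y)

theorem mono {F' : Filter ι} (h : WeakTendsto f F g) (hF : F' ≤ F) : WeakTendsto f F' g :=
  fun y => (h y).mono_left hF

theorem add (h : WeakTendsto f F g) (h' : WeakTendsto f' F g') :
    WeakTendsto (fun n => f n + f' n) F (g + g') := fun y => by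
  simpa only [inner_add_right] using (h y).add (h' y)

theorem sub (h : WeakTendsto f F g) (h' : WeakTendsto f' F g') :
    WeakTendsto (fun n => f n - f' n) F (g - g') := fun y => by
  simpa only [inner_sub_right] using (h y).sub (h' y)

theorem sum {κ : Type*} {s : Finset κ} {f : κ → ι → X} {g : κ → X}
    (h : ∀ k ∈ s, WeakTendsto (f k) F (g k)) :
    WeakTendsto (fun n => ∑ k ∈ s, f k n) F (∑ k ∈ s, g k) := fun y => by
  simpa only [inner_sum] using tendsto_finsetSum s fun k hk => h k hk y

theorem smul {c : ι → ℝ} {a : ℝ} (hc : Tendsto c F (𝓝 a)) (h : WeakTendsto f F g) :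
    WeakTendsto (fun n => c n • f n) F (a • g) := fun y => by
  simpa only [inner_smul_right] using hc.mul (h y)

variable [CompleteSpace X]

theorem map (K : X →L[ℝ] X) (h : WeakTendsto f F g) : WeakTendsto (fun n => K (f n)) F (K g) :=
  fun y => by simpa only [ContinuousLinearMap.adjoint_inner_left] using h (K.adjoint y)

end WeakTendsto

theorem weakTendsto_of_toWeakSpace {F : Filter ι} {f : ι → X}
    (h : Tendsto (fun n => toWeakSpace ℝ X (f n)) F (𝓝 0)) : WeakTendsto f F 0 := fun y => by
  have h1 := (WeakBilin.eval_continuous (topDualPairing ℝ X).flip (innerSL ℝ y)).tendsto 0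
  exact h1.comp h

variable [CompleteSpace X]

/-- Along an ultrafilter every bounded family in a Hilbert space converges weakly. -/
theorem exists_weakTendsto_of_norm_le (𝒰 : Ultrafilter ι) {f : ι → X} {c : ℝ}
    (hf : ∀ n, ‖f n‖ ≤ c) : ∃ g, WeakTendsto f 𝒰 g := by
  let φ : ι → WeakDual ℝ X := fun n => StrongDual.toWeakDual (InnerProductSpace.toDual ℝ X (f n))
  have hK := WeakDual.isCompact_closedBall (𝕜 := ℝ) (0 : StrongDual ℝ X) c
  obtain ⟨ψ, -, hψ⟩ := hK.ultrafilter_le_nhds' (𝒰.map φ)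
    (Ultrafilter.mem_map.2 (univ_mem' fun n => by
    change InnerProductSpace.toDual ℝ X (f n) ∈ Metric.closedBall 0 c
    rw [mem_closedBall_zero_iff, LinearIsometryEquiv.norm_map]
    exact hf n))
  refine ⟨(InnerProductSpace.toDual ℝ X).symm (WeakDual.toStrongDual ψ), fun y => ?_⟩
  have h1 : Tendsto (fun n => φ n y) 𝒰 (𝓝 (ψ y)) :=
    ((WeakDual.eval_continuous y).tendsto ψ).comp hψ
  have h2 : inner ℝ y ((InnerProductSpace.toDual ℝ X).symm (WeakDual.toStrongDual ψ)) = ψ y := by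
    rw [real_inner_comm, InnerProductSpace.toDual_symm_apply]
    rfl
  rw [h2]
  refine h1.congr fun n => ?_
  rw [real_inner_comm]
  rfl

/-- Compact operators map bounded weakly convergent families to convergent ones. -/
theorem WeakTendsto.tendsto_of_isCompactOperator {𝒰 : Ultrafilter ι} {f : ι → X} {g : X} {c : ℝ}
    (hf : ∀ n, ‖f n‖ ≤ c) (h : WeakTendsto f 𝒰 g) {K : X →L[ℝ] X} (hK : IsCompactOperator K) :
    Tendsto (fun n => K (f n)) 𝒰 (𝓝 (K g)) := by
  obtain ⟨s, hs, hs'⟩ := hK.image_closedBall_subset_compact c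
  obtain ⟨y, -, hy⟩ := hs.ultrafilter_le_nhds' (𝒰.map fun n => K (f n))
    (Ultrafilter.mem_map.2 (univ_mem' fun n => hs' ⟨f n, by simpa using hf n, rfl⟩))
  have hy' : Tendsto (fun n => K (f n)) 𝒰 (𝓝 y) := hy
  rwa [← (WeakTendsto.of_tendsto hy').unique (h.map K)]

end WeakLimits

section Profiles

variable {X : Type*} [NormedAddCommGroup X] [InnerProductSpace ℝ X] {N : ℕ}

/-- The bounded operator `1 + ∑ⱼ τⱼ⁻¹ Kⱼ τⱼ + C - μ G`. With `G = A⁻¹`, `Kⱼ = Bⱼ A⁻¹` and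
`C = R A⁻¹` it is `(A + ∑ⱼ τⱼ⁻¹ Bⱼ τⱼ + R - μ) A⁻¹`. -/
noncomputable def reducedOp (G : X →L[ℝ] X) (K : Fin N → X →L[ℝ] X) (τ : Fin N → X ≃ₗᵢ[ℝ] X)
    (C : X →L[ℝ] X) (μ : ℝ) (f : X) : X :=
  f + ∑ j, (τ j).symm (K j (τ j f)) + C f - μ • G f

theorem tendsto_zero_of_tendsto_norm {ι : Type*} {F : Filter ι} {x : ι → X} (C : ι → X →L[ℝ] X)
    (hC : Tendsto (fun n => ‖C n‖) F (𝓝 0)) {c : ℝ} (hx : ∀ n, ‖x n‖ ≤ c) :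
    Tendsto (fun n => C n (x n)) F (𝓝 0) := by
  refine squeeze_zero_norm (fun n => (C n).le_opNorm_of_le (hx n)) ?_
  simpa using hC.mul_const c

theorem tendsto_smul_zero {ι : Type*} {F : Filter ι} {x : ι → X} {a : ι → ℝ}
    (ha : Tendsto a F (𝓝 0)) {c : ℝ} (hx : ∀ n, ‖x n‖ ≤ c) :
    Tendsto (fun n => a n • x n) F (𝓝 0) := by
  refine squeeze_zero_norm (a := fun n => ‖a n‖ * c) (fun n => ?_) ?_
  · rw [norm_smul]
    exact mul_le_mul_of_nonneg_left (hx n) (norm_nonneg _)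
  · simpa using ha.norm.mul_const c

variable [CompleteSpace X] {G : X →L[ℝ] X} {K : Fin N → X →L[ℝ] X} {τ : Fin N → ℕ → X ≃ₗᵢ[ℝ] X}
  {C : ℕ → X →L[ℝ] X} {𝒰 : Ultrafilter ℕ}

/-- The weak limits `gⱼ` of `τⱼ fₙ`, for an approximate null family `fₙ` of the reduced operators,
solve the `j`-th limit equation: the interaction terms vanish weakly. -/
theorem weakLimit_solves (h𝒰 : ↑𝒰 ≤ (atTop : Filter ℕ))
    (hGτ : ∀ j n x, G (τ j n x) = τ j n (G x)) (hK : ∀ j, IsCompactOperator (K j))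
    (hC : Tendsto (fun n => ‖C n‖) atTop (𝓝 0))
    (hτ : ∀ u j k, j ≠ k → WeakTendsto (fun n => τ j n ((τ k n).symm u)) atTop 0)
    {f : ℕ → X} {c : ℝ} (hf : ∀ n, ‖f n‖ ≤ c) {s : ℕ → ℝ} {μ : ℝ} (hs : Tendsto s 𝒰 (𝓝 μ))
    (h : Tendsto (fun n => reducedOp G K (fun j => τ j n) (C n) (s n) (f n)) 𝒰 (𝓝 0))
    {g : Fin N → X} (hg : ∀ j, WeakTendsto (fun n => τ j n (f n)) 𝒰 (g j)) (j : Fin N) :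
    g j + K j (g j) - μ • G (g j) = 0 := by
  have hfτ : ∀ l n, ‖τ l n (f n)‖ ≤ c := fun l n => by simpa using hf n
  have h0 : Tendsto (fun n => τ j n (reducedOp G K (fun j => τ j n) (C n) (s n) (f n))) 𝒰
      (𝓝 0) := by
    rw [tendsto_zero_iff_norm_tendsto_zero] at h ⊢
    simpa using h
  have hKl : ∀ l, Tendsto (fun n => K l (τ l n (f n))) 𝒰 (𝓝 (K l (g l))) := fun l =>
    (hg l).tendsto_of_isCompactOperator (hfτ l) (hK l)
  -- by compactness `K l (τ l n (f n))` converges in norm, and the frames `j ≠ l` separate weakly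
  have hsum : ∀ l ∈ Finset.univ,
      WeakTendsto (fun n => τ j n ((τ l n).symm (K l (τ l n (f n))))) 𝒰
        (if l = j then K j (g j) else 0) := by
    intro l _
    split_ifs with hl
    · subst hl
      simpa using WeakTendsto.of_tendsto (hKl l)
    · have h1 := (hτ (K l (g l)) j l (Ne.symm hl)).mono h𝒰
      have h2 : Tendsto (fun n => τ j n ((τ l n).symm (K l (τ l n (f n)) - K l (g l)))) 𝒰
          (𝓝 0) := by
        have := tendsto_sub_nhds_zero_iff.2 (hKl l)
        rw [tendsto_zero_iff_norm_tendsto_zero] at this ⊢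
        simpa only [LinearIsometryEquiv.norm_map] using this
      simpa using h1.add (WeakTendsto.of_tendsto h2)
  have hCf : Tendsto (fun n => τ j n (C n (f n))) 𝒰 (𝓝 0) := by
    have := (tendsto_zero_of_tendsto_norm C hC hf).mono_left h𝒰
    rw [tendsto_zero_iff_norm_tendsto_zero] at this ⊢
    simpa using this
  have h1 := (((hg j).add (WeakTendsto.sum hsum)).add (WeakTendsto.of_tendsto hCf)).sub
    (WeakTendsto.smul hs ((hg j).map G))
  have h2 := WeakTendsto.of_tendsto h0
  simp only [reducedOp, map_add, map_sub, map_sum, map_smul] at h2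
  simp only [hGτ, Finset.sum_ite_eq', Finset.mem_univ, if_true, add_zero] at h1
  exact h1.unique h2

/-- If all the weak limits vanish and `1 - μ G` is proper on weakly null families, then an
approximate null family of the reduced operators tends to zero. -/
theorem tendsto_zero_of_weakTendsto_zero (h𝒰 : ↑𝒰 ≤ (atTop : Filter ℕ))
    (hGτ : ∀ j n x, G (τ j n x) = τ j n (G x)) (hK : ∀ j, IsCompactOperator (K j))
    (hC : Tendsto (fun n => ‖C n‖) atTop (𝓝 0))
    {f : ℕ → X} {c : ℝ} (hf : ∀ n, ‖f n‖ ≤ c) {s : ℕ → ℝ} {μ : ℝ} (hs : Tendsto s 𝒰 (𝓝 μ))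
    (hG : ∀ r : ℕ → X, (∀ n, ‖r n‖ ≤ c) → WeakTendsto r 𝒰 0 →
      Tendsto (fun n => r n - μ • G (r n)) 𝒰 (𝓝 0) → Tendsto r 𝒰 (𝓝 0))
    (h : Tendsto (fun n => reducedOp G K (fun j => τ j n) (C n) (s n) (f n)) 𝒰 (𝓝 0))
    (j₀ : Fin N) (hg : ∀ j, WeakTendsto (fun n => τ j n (f n)) 𝒰 0) :
    Tendsto f 𝒰 (𝓝 0) := by
  have hfτ : ∀ l n, ‖τ l n (f n)‖ ≤ c := fun l n => by simpa using hf n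
  have hsum : Tendsto (fun n => ∑ l, (τ l n).symm (K l (τ l n (f n)))) 𝒰 (𝓝 0) := by
    rw [← Finset.sum_const_zero (s := (Finset.univ : Finset (Fin N)))]
    refine tendsto_finsetSum _ fun l _ => ?_
    have := (hg l).tendsto_of_isCompactOperator (hfτ l) (hK l)
    rw [map_zero, tendsto_zero_iff_norm_tendsto_zero] at this
    rw [tendsto_zero_iff_norm_tendsto_zero]
    simpa using this
  have hCf := (tendsto_zero_of_tendsto_norm C hC hf).mono_left h𝒰
  have hsG : Tendsto (fun n => (s n - μ) • G (f n)) 𝒰 (𝓝 0) :=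
    tendsto_smul_zero (tendsto_sub_nhds_zero_iff.2 hs) fun n => G.le_opNorm_of_le (hf n)
  have h1 : Tendsto (fun n => f n - μ • G (f n)) 𝒰 (𝓝 0) := by
    have h2 := ((h.sub hsum).sub hCf).add hsG
    rw [sub_zero, sub_zero, add_zero] at h2
    refine h2.congr fun n => ?_
    simp only [reducedOp]
    module
  have h3 := hG _ (hfτ j₀) (hg j₀) (by
    rw [tendsto_zero_iff_norm_tendsto_zero] at h1 ⊢
    refine h1.congr fun n => ?_
    rw [hGτ, ← map_smul (τ j₀ n), ← map_sub (τ j₀ n), LinearIsometryEquiv.norm_map])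
  rw [tendsto_zero_iff_norm_tendsto_zero] at h3 ⊢
  simpa using h3

end Profiles

/-! ### Bounded form of the unbounded operators -/

section Maps

variable {𝕜 E : Type*} [RCLike 𝕜] [NormedAddCommGroup E] [InnerProductSpace 𝕜 E]
  {T U : E →ₗ.[𝕜] E} {x y z : E}

/-- `x` lies in the domain of the unbounded operator `T`, and `T x = y`. -/
def Maps (T : E →ₗ.[𝕜] E) (x y : E) : Prop := ∃ h : x ∈ T.domain, T ⟨x, h⟩ = y

theorem Maps.add (h : Maps T x y) (h' : Maps U x z) : Maps (T + U) x (y + z) := by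
  obtain ⟨h1, rfl⟩ := h
  obtain ⟨h2, rfl⟩ := h'
  exact ⟨⟨h1, h2⟩, rfl⟩

theorem Maps.sum {ι : Type*} {s : Finset ι} {T : ι → E →ₗ.[𝕜] E} {y : ι → E}
    (h : ∀ j ∈ s, Maps (T j) x (y j)) : Maps (∑ j ∈ s, T j) x (∑ j ∈ s, y j) := by
  classical
  induction s using Finset.induction_on with
  | empty => exact ⟨Submodule.mem_top, rfl⟩
  | insert a s ha ih =>
    rw [Finset.sum_insert ha, Finset.sum_insert ha]
    exact (h a (Finset.mem_insert_self a s)).add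
      (ih fun j hj => h j (Finset.mem_insert_of_mem hj))

theorem IsGivenBy.maps {C : E →L[𝕜] E} (h : IsGivenBy T C) (x : E) : Maps T x (C x) := by
  rw [IsGivenBy] at h
  subst h
  exact ⟨Submodule.mem_top, rfl⟩

end Maps

section RealOperators

variable {X : Type*} [NormedAddCommGroup X] [InnerProductSpace ℝ X] {A T : X →ₗ.[ℝ] X}

theorem Maps.conj {τ : X ≃ₗᵢ[ℝ] X} {x y : X} (h : Maps T (τ x) y) :
    Maps (conj τ T) x (τ.symm y) := by
  obtain ⟨h1, rfl⟩ := h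
  exact ⟨h1, rfl⟩

/-- If `0 ∈ ρ(A)`, the real operator `A` has a bounded inverse on the real space itself. -/
theorem exists_bounded_inverse (h : (0 : ℂ) ∈ resolventSet A) :
    ∃ G : X →L[ℝ] X, (∀ y, Maps A (G y) y) ∧ ∀ x : A.domain, G (A x) = x := by
  obtain ⟨S, hS⟩ := h
  refine ⟨LinearMap.mkContinuous
    { toFun := fun x => (S (Complexification.mk x 0)).re
      map_add' := fun x y => by rw [mk_zero_add, map_add, Complexification.re_add]
      map_smul' := fun c x => by
        have h1 : Complexification.mk (c • x) (0 : X) = (c : ℂ) • Complexification.mk x 0 :=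
          Complexification.ext
            (by rw [Complexification.re_smul, Complex.ofReal_re, Complex.ofReal_im, zero_smul,
              sub_zero]; rfl)
            (by rw [Complexification.im_smul, Complex.ofReal_re, Complex.ofReal_im, zero_smul,
              add_zero, Complexification.im_mk, Complexification.im_mk, smul_zero])
        rw [h1, map_smul, Complexification.re_smul, Complex.ofReal_re, Complex.ofReal_im,
          zero_smul, sub_zero, RingHom.id_apply] } ‖S‖ ?_, fun y => ?_, fun x => ?_⟩
  · intro x
    refine le_trans ?_ ((S.le_opNorm (Complexification.mk x 0)).trans_eq (by rw [norm_mk_zero]))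
    refine (sq_le_sq₀ (norm_nonneg _) (norm_nonneg _)).1 ?_
    rw [Complexification.norm_sq_eq (S (Complexification.mk x 0))]
    exact le_add_of_nonneg_right (sq_nonneg _)
  · obtain ⟨hd, hy⟩ := hS.1 (Complexification.mk y 0)
    rw [zero_smul, sub_zero] at hy
    exact ⟨hd.1, congrArg Complexification.re hy⟩
  · obtain ⟨hd, hx⟩ := complexify_mk_zero x
    have h1 := hS.2 ⟨_, hd⟩
    rw [hx, zero_smul, sub_zero] at h1
    exact congrArg Complexification.re h1

theorem Maps.inverse {G : X →L[ℝ] X} (hAG : ∀ y, Maps A (G y) y)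
    (hGA : ∀ x : A.domain, G (A x) = x) (y : X) : Maps A.inverse y (G y) := by
  have hker : A.toFun.ker = ⊥ := by
    refine LinearMap.ker_eq_bot'.2 fun x hx => ?_
    have h1 := hGA x
    have h2 : A x = 0 := hx
    rw [h2, map_zero] at h1
    exact Subtype.ext h1.symm
  obtain ⟨h1, h2⟩ := hAG y
  have h3 : y ∈ A.inverse.domain := by
    rw [LinearPMap.inverse_domain]
    exact ⟨⟨G y, h1⟩, h2⟩
  exact ⟨h3, LinearPMap.inverse_apply_eq hker (y := ⟨y, h3⟩) (x := ⟨G y, h1⟩) h2⟩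

/-- If `B A⁻¹` is the bounded operator `C`, then `B` maps `A⁻¹ y` to `C y`. -/
theorem maps_of_isGivenBy_comp_inverse {B : X →ₗ.[ℝ] X} {G C : X →L[ℝ] X}
    (hAG : ∀ y, Maps A (G y) y) (hGA : ∀ x : A.domain, G (A x) = x)
    (hC : IsGivenBy (opComp B A.inverse) C) (y : X) : Maps B (G y) (C y) := by
  obtain ⟨⟨h1, h2⟩, h3⟩ := hC.maps y
  obtain ⟨h4, h5⟩ := Maps.inverse hAG hGA y
  have h6 : ∃ h : A.inverse ⟨y, h1⟩ ∈ B.domain, B ⟨A.inverse ⟨y, h1⟩, h⟩ = C y := ⟨h2, h3⟩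
  rwa [h5] at h6

theorem commute_of_conj_eq {G : X →L[ℝ] X} (hAG : ∀ y, Maps A (G y) y)
    (hGA : ∀ x : A.domain, G (A x) = x) {τ : X ≃ₗᵢ[ℝ] X} (h : conj τ A = A) (x : X) :
    G (τ x) = τ (G x) := by
  have h1 := hAG x
  rw [← h] at h1
  obtain ⟨h2, h3⟩ := h1
  have h4 : A ⟨τ (G x), h2⟩ = τ x :=
    (τ.apply_symm_apply (A ⟨τ (G x), h2⟩)).symm.trans (congrArg τ h3)
  rw [← h4]
  exact hGA ⟨τ (G x), h2⟩

theorem exists_isolating_radius {δ l : ℝ} (hfin : FiniteSpectrumBelow T δ) (hl : l < δ) :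
    ∃ ε₀ > 0, l + ε₀ ≤ δ ∧ ∀ s : ℝ, s ≠ l → |s - l| < ε₀ → (s : ℂ) ∈ resolventSet T := by
  have hcl : IsClosed ({s : ℝ | s < δ ∧ (s : ℂ) ∈ spectrum T} \ {l}) :=
    (hfin.1.subset Set.sdiff_subset).isClosed
  obtain ⟨r, hr, hball⟩ := Metric.isOpen_iff.1 hcl.isOpen_compl l (by simp)
  refine ⟨min r (δ - l), lt_min hr (by linarith), by linarith [min_le_right r (δ - l)],
    fun s hs hsl => ?_⟩
  by_contra hcon
  have h1 : s ∈ Metric.ball l r := hsl.trans_le (min_le_left _ _)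
  refine hball h1 ⟨⟨?_, hcon⟩, hs⟩
  linarith [(abs_lt.1 (hsl.trans_le (min_le_right _ _))).2]

variable [CompleteSpace X]

theorem tendsto_starProjection_of_weakTendsto_zero {ι : Type*} {𝒰 : Ultrafilter ι}
    (W : Submodule ℝ X) [FiniteDimensional ℝ W] {v : ι → X} {c : ℝ} (hv : ∀ n, ‖v n‖ ≤ c)
    (h : WeakTendsto v 𝒰 0) : Tendsto (fun n => W.starProjection (v n)) 𝒰 (𝓝 0) := by
  have hcomp : IsCompactOperator (W.starProjection : X →L[ℝ] X) := by
    have := FiniteDimensional.proper ℝ W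
    have h1 : IsCompactOperator (W.orthogonalProjectionOnto : X →L[ℝ] W) :=
      ⟨Metric.closedBall 0 1, isCompact_closedBall 0 1, by
        refine W.orthogonalProjectionOnto.continuous.continuousAt.preimage_mem_nhds ?_
        rw [map_zero]
        exact Metric.closedBall_mem_nhds 0 one_pos⟩
    exact h1.clm_comp W.subtypeL
  simpa using h.tendsto_of_isCompactOperator hv hcomp

/-- Below `δ` the self-adjoint operator `A` has no essential spectrum: with `G = A⁻¹`, a bounded
weakly null family that is almost annihilated by `1 - μ G = (A - μ) A⁻¹` tends to zero. -/
theorem tendsto_zero_of_sub_smul_tendsto_zero (hA : IsSelfAdjoint A) {δ μ : ℝ}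
    (hfin : FiniteSpectrumBelow A δ) (hμ : μ < δ) {G : X →L[ℝ] X} (hAG : ∀ y, Maps A (G y) y)
    {𝒰 : Ultrafilter ℕ} {r : ℕ → X} {c : ℝ} (hr : ∀ n, ‖r n‖ ≤ c) (hr0 : WeakTendsto r 𝒰 0)
    (h : Tendsto (fun n => r n - μ • G (r n)) 𝒰 (𝓝 0)) : Tendsto r 𝒰 (𝓝 0) := by
  obtain ⟨ε₀, hε₀, hδ, hiso⟩ := exists_isolating_radius hfin hμ
  have hε : 0 < ε₀ / 2 := by linarith
  have hright : ((μ + ε₀ / 2 : ℝ) : ℂ) ∈ resolventSet A := by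
    refine hiso _ (by linarith) ?_
    rw [add_sub_cancel_left, abs_of_pos hε]
    linarith
  have hleft : ((μ - ε₀ / 2 : ℝ) : ℂ) ∈ resolventSet A := by
    refine hiso _ (by linarith) ?_
    rw [abs_sub_comm, sub_sub_cancel, abs_of_pos hε]
    linarith
  obtain ⟨-, hW1, hW2⟩ := finrank_rieszRange_and_estimates hA hε (by linarith) hfin hright hleft
  have hWfd := finiteDimensional_windowSpace (l := μ) (ε := ε₀ / 2) hfin (by linarith)
  set ε := ε₀ / 2
  set W := windowSpace A μ ε with hW
  have hv0 : WeakTendsto (fun n => G (r n)) 𝒰 0 := by simpa using hr0.map G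
  have hp := tendsto_starProjection_of_weakTendsto_zero W
    (fun n => G.le_opNorm_of_le (hr n)) hv0
  have hbound : ∀ n, ε * ‖G (r n) - W.starProjection (G (r n))‖ ≤
      ‖r n - μ • G (r n)‖ + ε * ‖W.starProjection (G (r n))‖ := by
    intro n
    obtain ⟨hd, hAr⟩ := hAG (r n)
    have hpW : W.starProjection (G (r n)) ∈ W := W.starProjection_apply_mem _
    have hpd := windowSpace_le_domain A μ ε hpW
    let v : A.domain := ⟨_, hd⟩
    let p : A.domain := ⟨_, hpd⟩
    have h1 := hW2 (v - p) (W.sub_starProjection_mem_orthogonal (G (r n)))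
    have h2 := hW1 p hpW
    have h3 : A (v - p) - μ • ((v - p : A.domain) : X) =
        (r n - μ • G (r n)) - (A p - μ • (p : X)) := by
      rw [A.map_sub, Submodule.coe_sub, show A v = r n from hAr]
      change r n - A p - μ • (G (r n) - p) = r n - μ • G (r n) - (A p - μ • (p : X))
      module
    rw [h3] at h1
    exact h1.trans ((norm_sub_le _ _).trans (add_le_add_right h2 _))
  have hq : Tendsto (fun n => G (r n) - W.starProjection (G (r n))) 𝒰 (𝓝 0) := by
    refine squeeze_zero_norm (fun n => (le_div_iff₀' hε).2 (hbound n)) ?_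
    simpa using ((tendsto_zero_iff_norm_tendsto_zero.1 h).add
      ((tendsto_zero_iff_norm_tendsto_zero.1 hp).const_mul ε)).div_const ε
  have hG := (hq.add hp).const_smul μ
  have := h.add hG
  simpa using this

end RealOperators

/-! ### Counting eigenvalues of decoupling families -/

section Counting

variable {X : Type*} [NormedAddCommGroup X] [InnerProductSpace ℝ X] {N : ℕ}

theorem finrank_comap_of_injective {G : X →L[ℝ] X} (hG : Function.Injective G)
    {V : Submodule ℝ X} (hV : ∀ x ∈ V, ∃ f, G f = x) [FiniteDimensional ℝ V] :
    FiniteDimensional ℝ (V.comap (G : X →ₗ[ℝ] X)) ∧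
      Module.finrank ℝ (V.comap (G : X →ₗ[ℝ] X)) = Module.finrank ℝ V := by
  have h1 : (V.comap (G : X →ₗ[ℝ] X)).map (G : X →ₗ[ℝ] X) = V :=
    Submodule.map_comap_eq_of_le fun x hx => hV x hx
  have h2 := (Submodule.equivMapOfInjective (G : X →ₗ[ℝ] X) hG (V.comap (G : X →ₗ[ℝ] X))).trans
    (LinearEquiv.ofEq _ _ h1)
  exact ⟨h2.symm.finiteDimensional, h2.finrank_eq⟩

variable [CompleteSpace X]

/-- The asymptotically decoupling family `Lₙ` with limit operators `Tⱼ`, written through the common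
bounded inverse `G = A⁻¹`: `Tⱼ G = 1 + Kⱼ` and `Lₙ G = 1 + ∑ⱼ τⱼ⁻¹ Kⱼ τⱼ + Cₙ`, with `Kⱼ` compact
and `Cₙ → 0` in norm. -/
structure IsDecouplingFamily (T : Fin N → X →ₗ.[ℝ] X) (L : ℕ → X →ₗ.[ℝ] X) (G : X →L[ℝ] X)
    (K : Fin N → X →L[ℝ] X) (C : ℕ → X →L[ℝ] X) (τ : Fin N → ℕ → X ≃ₗᵢ[ℝ] X) (δ : ℝ) : Prop where
  injective : Function.Injective G
  comm : ∀ j n x, G (τ j n x) = τ j n (G x)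
  /-- `A` has no essential spectrum below `δ`. -/
  proper : ∀ μ < δ, ∀ (𝒰 : Ultrafilter ℕ) (r : ℕ → X) (c : ℝ), (∀ n, ‖r n‖ ≤ c) →
    WeakTendsto r 𝒰 0 → Tendsto (fun n => r n - μ • G (r n)) 𝒰 (𝓝 0) → Tendsto r 𝒰 (𝓝 0)
  compact : ∀ j, IsCompactOperator (K j)
  norm_tendsto : Tendsto (fun n => ‖C n‖) atTop (𝓝 0)
  /-- The frames separate weakly. -/
  separation : ∀ u j k, j ≠ k → WeakTendsto (fun n => τ j n ((τ k n).symm u)) atTop 0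
  selfAdjoint_limit : ∀ j, IsSelfAdjoint (T j)
  spectrum_limit : ∀ j, FiniteSpectrumBelow (T j) δ
  maps_limit : ∀ j f, Maps (T j) (G f) (f + K j f)
  domain_limit : ∀ j, ∀ x ∈ (T j).domain, ∃ f, G f = x
  selfAdjoint_full : ∀ n, IsSelfAdjoint (L n)
  spectrum_full : ∀ n, FiniteSpectrumBelow (L n) δ
  maps_full : ∀ n f, Maps (L n) (G f) (f + ∑ j, (τ j n).symm (K j (τ j n f)) + C n f)
  domain_full : ∀ n, ∀ x ∈ (L n).domain, ∃ f, G f = x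

namespace IsDecouplingFamily

variable {T : Fin N → X →ₗ.[ℝ] X} {L : ℕ → X →ₗ.[ℝ] X} {G : X →L[ℝ] X}
  {K : Fin N → X →L[ℝ] X} {C : ℕ → X →L[ℝ] X} {τ : Fin N → ℕ → X ≃ₗᵢ[ℝ] X} {δ : ℝ}

theorem mem_eigenspace_limit (h : IsDecouplingFamily T L G K C τ δ) {j : Fin N} {s : ℝ} {f : X} :
    G f ∈ eigenspace (T j) s ↔ f + K j f - s • G f = 0 := by
  obtain ⟨h1, h2⟩ := h.maps_limit j f
  rw [mem_eigenspace_iff, sub_eq_zero, ← h2]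
  exact ⟨fun ⟨_, h⟩ => h, fun h => ⟨h1, h⟩⟩

/-- A point `s ∉ ρ(Lₙ)` below `δ` is an eigenvalue, so it gives a null vector of the reduced
operator. -/
theorem exists_unit_null_vector (h : IsDecouplingFamily T L G K C τ δ) {n : ℕ} {s : ℝ}
    (hs : s < δ) (hsL : (s : ℂ) ∉ resolventSet (L n)) :
    ∃ f : X, ‖f‖ = 1 ∧ reducedOp G K (fun j => τ j n) (C n) s f = 0 := by
  obtain ⟨v, hv, hv0⟩ := (Submodule.ne_bot_iff _).1 ((h.spectrum_full n).2 s hs hsL).1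
  obtain ⟨hd, hLv⟩ := mem_eigenspace_iff.1 hv
  obtain ⟨f, rfl⟩ := h.domain_full n v hd
  have hf : f ≠ 0 := fun hf => hv0 (by rw [hf, map_zero])
  have hmem : G (‖f‖⁻¹ • f) ∈ eigenspace (L n) s := by
    rw [map_smul]
    exact Submodule.smul_mem _ _ hv
  obtain ⟨h1, h2⟩ := mem_eigenspace_iff.1 hmem
  obtain ⟨h3, h4⟩ := h.maps_full n (‖f‖⁻¹ • f)
  refine ⟨‖f‖⁻¹ • f, norm_smul_inv_norm hf, ?_⟩
  rw [reducedOp, ← h4, sub_eq_zero]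
  exact h2

/-- Concentration: a normalized approximate null family of the reduced operators has a nonzero
weak limit in one of the moving frames, and all these limits solve the limit equations. -/
theorem exists_weakLimits (h : IsDecouplingFamily T L G K C τ δ) (hN : 1 ≤ N) {𝒰 : Ultrafilter ℕ}
    (h𝒰 : ↑𝒰 ≤ (atTop : Filter ℕ)) {f : ℕ → X} (hf : ∀ n, ‖f n‖ ≤ 1)
    (hf1 : ∀ᶠ n in (𝒰 : Filter ℕ), ‖f n‖ = 1) {s : ℕ → ℝ} {μ : ℝ} (hμ : μ < δ)
    (hs : Tendsto s 𝒰 (𝓝 μ))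
    (hred : Tendsto (fun n => reducedOp G K (fun j => τ j n) (C n) (s n) (f n)) 𝒰 (𝓝 0)) :
    ∃ g : Fin N → X, (∀ j, WeakTendsto (fun n => τ j n (f n)) 𝒰 (g j)) ∧
      (∀ j, G (g j) ∈ eigenspace (T j) μ) ∧ ∃ j, g j ≠ 0 := by
  have hex : ∀ j, ∃ g, WeakTendsto (fun n => τ j n (f n)) 𝒰 g := fun j =>
    exists_weakTendsto_of_norm_le 𝒰 (c := 1) fun n => by simpa using hf n
  choose g hg using hex
  refine ⟨g, hg, fun j => h.mem_eigenspace_limit.2 (weakLimit_solves h𝒰 h.comm h.compact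
    h.norm_tendsto h.separation hf hs hred hg j), ?_⟩
  by_contra! hcon
  have h0 := tendsto_zero_of_weakTendsto_zero h𝒰 h.comm h.compact h.norm_tendsto hf hs
    (fun r => h.proper μ hμ 𝒰 r 1) hred ⟨0, hN⟩ fun j => by simpa only [hcon] using hg j
  have h1 : Tendsto (fun n => ‖f n‖) 𝒰 (𝓝 1) :=
    tendsto_const_nhds.congr' (hf1.mono fun n hn => hn.symm)
  have h2 := tendsto_nhds_unique h1 h0.norm
  rw [norm_zero] at h2
  exact one_ne_zero h2

/-- No eigenvalue of `Lₙ` persists on a compact part of the common resolvent set. -/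
theorem eventually_mem_resolventSet (h : IsDecouplingFamily T L G K C τ δ) (hN : 1 ≤ N)
    {I : Set ℝ} (hI : IsCompact I) (hIδ : ∀ s ∈ I, s < δ)
    (hIT : ∀ s ∈ I, ∀ j, (s : ℂ) ∈ resolventSet (T j)) :
    ∀ᶠ n in atTop, ∀ s ∈ I, (s : ℂ) ∈ resolventSet (L n) := by
  by_contra hcon
  set bad : Set ℕ := {n | ¬ ∀ s ∈ I, (s : ℂ) ∈ resolventSet (L n)} with hbad
  have hne : (atTop ⊓ 𝓟 bad).NeBot := frequently_mem_iff_neBot.1 (not_eventually.1 hcon)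
  -- an ultrafilter finer than `atTop` that concentrates on the exceptional indices
  let 𝒰 := Ultrafilter.of (atTop ⊓ 𝓟 bad)
  have h𝒰 : ↑𝒰 ≤ atTop ⊓ 𝓟 bad := Ultrafilter.of_le _
  have hb : ∀ᶠ n in (𝒰 : Filter ℕ), n ∈ bad :=
    (h𝒰.trans inf_le_right) (mem_principal_self bad)
  have hex : ∀ n, ∃ s : ℝ, ∃ f : X, ‖f‖ ≤ 1 ∧
      (n ∈ bad → s ∈ I ∧ ‖f‖ = 1 ∧ reducedOp G K (fun j => τ j n) (C n) s f = 0) := by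
    intro n
    by_cases hn : n ∈ bad
    · obtain ⟨s, hs, hsL⟩ : ∃ s ∈ I, (s : ℂ) ∉ resolventSet (L n) := by
        simpa [hbad] using hn
      obtain ⟨f, hf1, hf2⟩ := h.exists_unit_null_vector (hIδ s hs) hsL
      exact ⟨s, f, hf1.le, fun _ => ⟨hs, hf1, hf2⟩⟩
    · exact ⟨0, 0, by simp, fun h => absurd h hn⟩
  choose s f hf hsf using hex
  obtain ⟨μ, hμ, hsμ⟩ := hI.ultrafilter_le_nhds' (𝒰.map s)
    (Ultrafilter.mem_map.2 (hb.mono fun n hn => (hsf n hn).1))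
  obtain ⟨g, -, hg, j, hj⟩ := h.exists_weakLimits hN (h𝒰.trans inf_le_left) hf
    (hb.mono fun n hn => (hsf n hn).2.1) (hIδ μ hμ) hsμ
    (tendsto_const_nhds.congr' (hb.mono fun n hn => (hsf n hn).2.2.symm))
  have h1 := hg j
  rw [eigenspace_eq_bot_of_mem_resolventSet (hIT μ hμ j), Submodule.mem_bot] at h1
  exact hj (h.injective (h1.trans (map_zero G).symm))

theorem exists_reducedOp_eq (h : IsDecouplingFamily T L G K C τ δ) (n : ℕ) (l : ℝ) (f : X) :
    ∃ v : (L n).domain, (v : X) = G f ∧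
      reducedOp G K (fun j => τ j n) (C n) l f = L n v - l • (v : X) := by
  obtain ⟨h1, h2⟩ := h.maps_full n f
  exact ⟨⟨_, h1⟩, rfl, by rw [h2, reducedOp]⟩

/-- Near an isolated point `l` of the limit spectra, the eigenvalues of `Lₙ` accumulate at `l`
only, so `Lₙ - l` tends to zero on its window space. -/
theorem eventually_window (h : IsDecouplingFamily T L G K C τ δ) (hN : 1 ≤ N) {l ε : ℝ}
    (hε : 0 < ε) (hlε : l + ε < δ)
    (hiso : ∀ s : ℝ, s ≠ l → |s - l| ≤ ε → ∀ j, (s : ℂ) ∈ resolventSet (T j))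
    {η : ℝ} (hη : 0 < η) (hηε : η ≤ ε) :
    ∀ᶠ n in atTop, ((l + ε : ℝ) : ℂ) ∈ resolventSet (L n) ∧
      ((l - ε : ℝ) : ℂ) ∈ resolventSet (L n) ∧
      ∀ v : (L n).domain, (v : X) ∈ windowSpace (L n) l ε →
        ‖L n v - l • (v : X)‖ ≤ η * ‖(v : X)‖ := by
  have hI := h.eventually_mem_resolventSet hN
    (I := Set.Icc (l - ε) (l - η) ∪ Set.Icc (l + η) (l + ε)) (isCompact_Icc.union isCompact_Icc)
    (by rintro s (hs | hs) <;> linarith [hs.1, hs.2])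
    (by
      rintro s (hs | hs)
      · exact hiso s (by linarith [hs.2]) (abs_le.2 ⟨by linarith [hs.1], by linarith [hs.2]⟩)
      · exact hiso s (by linarith [hs.1]) (abs_le.2 ⟨by linarith [hs.1], by linarith [hs.2]⟩))
  filter_upwards [hI] with n hn
  have hr : ∀ t, η ≤ t → t ≤ ε → ((l + t : ℝ) : ℂ) ∈ resolventSet (L n) := fun t h1 h2 =>
    hn _ (Or.inr ⟨by linarith, by linarith⟩)
  have hl : ∀ t, η ≤ t → t ≤ ε → ((l - t : ℝ) : ℂ) ∈ resolventSet (L n) := fun t h1 h2 =>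
    hn _ (Or.inl ⟨by linarith, by linarith⟩)
  refine ⟨hr ε hηε le_rfl, hl ε hηε le_rfl, fun v hv => ?_⟩
  refine (finrank_rieszRange_and_estimates (h.selfAdjoint_full n) hη (by linarith)
    (h.spectrum_full n) (hr η le_rfl hηε) (hl η le_rfl hηε)).2.1 v ?_
  refine (iSup_le fun s => ?_ : windowSpace (L n) l ε ≤ windowSpace (L n) l η) hv
  have hs : |(s : ℝ) - l| < ε := s.2
  obtain ⟨hs1, hs2⟩ := abs_lt.1 hs
  by_cases hsη : |(s : ℝ) - l| < η
  · exact le_iSup (fun s : Metric.ball l η => eigenspace (L n) s) ⟨s, hsη⟩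
  · rw [eigenspace_eq_bot_of_mem_resolventSet]
    · exact bot_le
    · refine hn _ ?_
      rcases le_abs'.1 (not_lt.1 hsη) with h1 | h1
      · exact Or.inl ⟨by linarith, by linarith⟩
      · exact Or.inr ⟨by linarith, by linarith⟩

/-- Upper bound for the number of eigenvalues: for large `n` a vector `f` with `G f` in the window
space of `Lₙ` is determined by the projections of all `τⱼ f` to the spaces
`M j = ker (1 + Kⱼ - l G)`. -/
theorem eventually_finrank_le (h : IsDecouplingFamily T L G K C τ δ) (hN : 1 ≤ N) {l ε : ℝ}
    (hε : 0 < ε) (hlε : l + ε < δ)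
    (hiso : ∀ s : ℝ, s ≠ l → |s - l| ≤ ε → ∀ j, (s : ℂ) ∈ resolventSet (T j))
    {M : Fin N → Submodule ℝ X} (hM : ∀ j f, f ∈ M j ↔ G f ∈ eigenspace (T j) l)
    (hMfd : ∀ j, FiniteDimensional ℝ (M j)) :
    ∀ᶠ n in atTop,
      Module.finrank ℝ ((windowSpace (L n) l ε).comap (G : X →ₗ[ℝ] X)) ≤
        ∑ j, Module.finrank ℝ (M j) := by
  by_contra hcon
  set bad : Set ℕ := {n | ¬ Module.finrank ℝ ((windowSpace (L n) l ε).comap (G : X →ₗ[ℝ] X)) ≤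
        ∑ j, Module.finrank ℝ (M j)} with hbad
  have hne : (atTop ⊓ 𝓟 bad).NeBot := frequently_mem_iff_neBot.1 (not_eventually.1 hcon)
  let 𝒰 := Ultrafilter.of (atTop ⊓ 𝓟 bad)
  have h𝒰 : ↑𝒰 ≤ atTop ⊓ 𝓟 bad := Ultrafilter.of_le _
  have hb : ∀ᶠ n in (𝒰 : Filter ℕ), n ∈ bad :=
    (h𝒰.trans inf_le_right) (mem_principal_self bad)
  have hex : ∀ n, ∃ f : X, ‖f‖ ≤ 1 ∧ (n ∈ bad → ‖f‖ = 1 ∧ G f ∈ windowSpace (L n) l ε ∧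
      ∀ j, τ j n f ∈ (M j)ᗮ) := by
    intro n
    by_cases hn : n ∈ bad
    · let J : (windowSpace (L n) l ε).comap (G : X →ₗ[ℝ] X) →ₗ[ℝ] (∀ j, M j) :=
        LinearMap.pi fun j => ((M j).orthogonalProjectionOnto : X →ₗ[ℝ] M j) ∘ₗ
          ((τ j n).toLinearEquiv : X →ₗ[ℝ] X) ∘ₗ Submodule.subtype _
      have hJ : ¬ Function.Injective J := fun hinj => hn (by
        rw [← Module.finrank_pi_fintype]
        exact LinearMap.finrank_le_finrank_of_injective hinj)
      rw [← LinearMap.ker_eq_bot, Submodule.eq_bot_iff] at hJ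
      push Not at hJ
      obtain ⟨f, hf, hf0⟩ := hJ
      have hf0' : (f : X) ≠ 0 := fun h => hf0 (Subtype.ext h)
      refine ⟨‖(f : X)‖⁻¹ • (f : X), (norm_smul_inv_norm hf0').le,
        fun _ => ⟨norm_smul_inv_norm hf0', ?_, fun j => ?_⟩⟩
      · rw [map_smul]
        exact Submodule.smul_mem _ _ f.2
      · rw [map_smul]
        refine Submodule.smul_mem _ _ ?_
        have h1 : (M j).orthogonalProjectionOnto (τ j n f) = 0 := congrFun hf j
        exact Submodule.orthogonalProjectionOnto_eq_zero_iff.1 h1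
    · exact ⟨0, by simp, fun h => absurd h hn⟩
  choose f hf hfb using hex
  have hred : Tendsto (fun n => reducedOp G K (fun j => τ j n) (C n) l (f n)) 𝒰 (𝓝 0) := by
    rw [Metric.tendsto_nhds]
    intro η₀ hη₀
    have hG1 : 0 < ‖G‖ + 1 := by positivity
    have hη : 0 < min ε (η₀ / (‖G‖ + 1)) := lt_min hε (by positivity)
    have h1 := (h.eventually_window hN hε hlε hiso hη (min_le_left _ _)).filter_mono
      (h𝒰.trans inf_le_left)
    filter_upwards [h1, hb] with n hn hnb
    obtain ⟨v, hv, hvred⟩ := h.exists_reducedOp_eq n l (f n)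
    have h2 := hn.2.2 v (hv ▸ (hfb n hnb).2.1)
    rw [dist_zero_right, hvred]
    have h3 : ‖(v : X)‖ < ‖G‖ + 1 := by
      rw [hv]
      exact ((G.le_opNorm_of_le (hf n)).trans_eq (mul_one _)).trans_lt (lt_add_one _)
    calc ‖L n v - l • (v : X)‖ ≤ min ε (η₀ / (‖G‖ + 1)) * ‖(v : X)‖ := h2
      _ < min ε (η₀ / (‖G‖ + 1)) * (‖G‖ + 1) := mul_lt_mul_of_pos_left h3 hη
      _ ≤ η₀ / (‖G‖ + 1) * (‖G‖ + 1) := mul_le_mul_of_nonneg_right (min_le_right _ _) hG1.le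
      _ = η₀ := div_mul_cancel₀ _ hG1.ne'
  obtain ⟨g, hgw, hg, j, hj⟩ := h.exists_weakLimits hN (h𝒰.trans inf_le_left) hf
    (hb.mono fun n hn => (hfb n hn).1) (by linarith) tendsto_const_nhds hred
  -- the weak limit lies in `M j` and is orthogonal to it
  have h1 : Tendsto (fun n => inner ℝ (g j) (τ j n (f n))) 𝒰 (𝓝 0) :=
    tendsto_const_nhds.congr' (hb.mono fun n hn =>
      (Submodule.inner_right_of_mem_orthogonal ((hM j _).2 (hg j)) ((hfb n hn).2.2 j)).symm)
  exact hj (inner_self_eq_zero.1 (tendsto_nhds_unique (hgw j (g j)) h1))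

/-- Lower bound for the number of eigenvalues: the translated limit eigenvectors are approximate
eigenvectors of `Lₙ`, so their projections to the window space of `Lₙ` stay independent. -/
theorem eventually_le_finrank (h : IsDecouplingFamily T L G K C τ δ) (hN : 1 ≤ N) {l ε : ℝ}
    (hε : 0 < ε) (hlε : l + ε < δ)
    (hiso : ∀ s : ℝ, s ≠ l → |s - l| ≤ ε → ∀ j, (s : ℂ) ∈ resolventSet (T j))
    {M : Fin N → Submodule ℝ X} (hM : ∀ j f, f ∈ M j ↔ G f ∈ eigenspace (T j) l)
    (hMfd : ∀ j, FiniteDimensional ℝ (M j)) :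
    ∀ᶠ n in atTop,
      ∑ j, Module.finrank ℝ (M j) ≤ Module.finrank ℝ (windowSpace (L n) l ε) := by
  by_contra hcon
  set bad : Set ℕ := {n | ¬ ∑ j, Module.finrank ℝ (M j) ≤
    Module.finrank ℝ (windowSpace (L n) l ε)} with hbad
  have hne : (atTop ⊓ 𝓟 bad).NeBot := frequently_mem_iff_neBot.1 (not_eventually.1 hcon)
  let 𝒰 := Ultrafilter.of (atTop ⊓ 𝓟 bad)
  have h𝒰 : ↑𝒰 ≤ atTop ⊓ 𝓟 bad := Ultrafilter.of_le _
  have h𝒰' : ↑𝒰 ≤ (atTop : Filter ℕ) := h𝒰.trans inf_le_left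
  have hb : ∀ᶠ n in (𝒰 : Filter ℕ), n ∈ bad :=
    (h𝒰.trans inf_le_right) (mem_principal_self bad)
  have hWfd : ∀ n, FiniteDimensional ℝ (windowSpace (L n) l ε) := fun n =>
    finiteDimensional_windowSpace (h.spectrum_full n) hlε.le
  have hex : ∀ n, ∃ p : ∀ j, M j, ‖p‖ ≤ 1 ∧ (n ∈ bad → ‖p‖ = 1 ∧
      G (∑ j, (τ j n).symm (p j : X)) ∈ (windowSpace (L n) l ε)ᗮ) := by
    intro n
    by_cases hn : n ∈ bad
    · let J : (∀ j, M j) →ₗ[ℝ] windowSpace (L n) l ε :=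
        ((windowSpace (L n) l ε).orthogonalProjectionOnto : X →ₗ[ℝ] windowSpace (L n) l ε) ∘ₗ
          (G : X →ₗ[ℝ] X) ∘ₗ ∑ j, ((τ j n).symm.toLinearEquiv : X →ₗ[ℝ] X) ∘ₗ
            (M j).subtype ∘ₗ LinearMap.proj j
      have hJ : ¬ Function.Injective J := fun hinj => hn (by
        rw [← Module.finrank_pi_fintype]
        exact LinearMap.finrank_le_finrank_of_injective hinj)
      rw [← LinearMap.ker_eq_bot, Submodule.eq_bot_iff] at hJ
      push Not at hJ
      obtain ⟨p, hp, hp0⟩ := hJ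
      have h1 : G (∑ j, (τ j n).symm (p j : X)) ∈ (windowSpace (L n) l ε)ᗮ := by
        rw [← Submodule.orthogonalProjectionOnto_eq_zero_iff]
        have h2 : J p = 0 := hp
        simpa [J, LinearMap.sum_apply] using h2
      refine ⟨‖p‖⁻¹ • p, (norm_smul_inv_norm hp0).le, fun _ => ⟨norm_smul_inv_norm hp0, ?_⟩⟩
      have h2 : ∑ j, (τ j n).symm ((‖p‖⁻¹ • p) j : X) =
          ‖p‖⁻¹ • ∑ j, (τ j n).symm (p j : X) := by
        rw [Finset.smul_sum]
        refine Finset.sum_congr rfl fun j _ => ?_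
        rw [Pi.smul_apply, Submodule.coe_smul, map_smul]
      rw [h2, map_smul]
      exact Submodule.smul_mem _ _ h1
    · exact ⟨0, by simp, fun h => absurd h hn⟩
  choose p hp hpb using hex
  -- extract a strong limit of the coefficient vectors
  obtain ⟨q, hq⟩ : ∃ q, Tendsto p 𝒰 (𝓝 q) := by
    have : ProperSpace (∀ j, M j) := FiniteDimensional.proper ℝ _
    obtain ⟨q, -, hq⟩ := (isCompact_closedBall (0 : ∀ j, M j) 1).ultrafilter_le_nhds' (𝒰.map p)
      (Ultrafilter.mem_map.2 (univ_mem' fun n => by simpa using hp n))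
    exact ⟨q, hq⟩
  have hq1 : ‖q‖ = 1 := tendsto_nhds_unique hq.norm
    (tendsto_const_nhds.congr' (hb.mono fun n hn => (hpb n hn).1.symm))
  have hpj : ∀ j, Tendsto (fun n => (p n j : X)) 𝒰 (𝓝 (q j : X)) := fun j =>
    (continuous_subtype_val.tendsto _).comp ((tendsto_pi_nhds.1 hq) j)
  set f : ℕ → X := fun n => ∑ j, (τ j n).symm (p n j : X) with hf
  have hfN : ∀ n, ‖f n‖ ≤ N := fun n => by
    refine (norm_sum_le _ _).trans ?_
    refine (Finset.sum_le_card_nsmul _ _ 1 fun j _ => ?_).trans_eq (by simp)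
    rw [LinearIsometryEquiv.norm_map]
    exact (norm_le_pi_norm (p n) j).trans (hp n)
  -- the weak limits of `τ k n (f n)` are the components of `q`
  have hw : ∀ k, WeakTendsto (fun n => τ k n (f n)) 𝒰 (q k : X) := by
    intro k
    have h1 : ∀ j ∈ Finset.univ, WeakTendsto (fun n => τ k n ((τ j n).symm (p n j : X))) 𝒰
        (if j = k then (q k : X) else 0) := by
      intro j _
      split_ifs with hjk
      · subst hjk
        simpa using WeakTendsto.of_tendsto (hpj j)
      · have h2 := (h.separation (q j : X) k j (Ne.symm hjk)).mono h𝒰'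
        have h3 : Tendsto (fun n => τ k n ((τ j n).symm ((p n j : X) - q j))) 𝒰 (𝓝 0) := by
          have := tendsto_sub_nhds_zero_iff.2 (hpj j)
          rw [tendsto_zero_iff_norm_tendsto_zero] at this ⊢
          simpa only [LinearIsometryEquiv.norm_map] using this
        simpa using h2.add (WeakTendsto.of_tendsto h3)
    have h2 := WeakTendsto.sum h1
    simp only [Finset.sum_ite_eq', Finset.mem_univ, if_true] at h2
    simpa only [hf, map_sum] using h2
  have hred : Tendsto (fun n => reducedOp G K (fun j => τ j n) (C n) l (f n)) 𝒰 (𝓝 0) := by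
    have h1 : Tendsto (fun n => ∑ k, (τ k n).symm
        ((p n k : X) + K k (τ k n (f n)) - l • G (p n k : X))) 𝒰 (𝓝 0) := by
      rw [← Finset.sum_const_zero (s := (Finset.univ : Finset (Fin N)))]
      refine tendsto_finsetSum _ fun k _ => ?_
      have h2 := (hw k).tendsto_of_isCompactOperator (c := N) (fun n => by simpa using hfN n)
        (h.compact k)
      have h3 := ((hpj k).add h2).sub (((G.continuous.tendsto _).comp (hpj k)).const_smul l)
      rw [h.mem_eigenspace_limit.1 ((hM k _).1 (q k).2)] at h3
      rw [tendsto_zero_iff_norm_tendsto_zero] at h3 ⊢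
      simpa only [LinearIsometryEquiv.norm_map, Function.comp_apply] using h3
    have h2 := (tendsto_zero_of_tendsto_norm C h.norm_tendsto hfN).mono_left h𝒰'
    have h3 := h1.add h2
    rw [add_zero] at h3
    refine h3.congr fun n => ?_
    have h4 : ∀ k x, (τ k n).symm (G x) = G ((τ k n).symm x) := fun k x => by
      rw [LinearIsometryEquiv.symm_apply_eq, ← h.comm, LinearIsometryEquiv.apply_symm_apply]
    simp only [reducedOp, map_add, map_sub, map_smul, h4, Finset.sum_add_distrib,
      Finset.sum_sub_distrib, ← Finset.smul_sum, ← map_sum]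
    change f n + _ - l • G (f n) + _ = f n + _ + _ - _
    abel
  have hG0 : Tendsto (fun n => G (f n)) 𝒰 (𝓝 0) := by
    refine squeeze_zero_norm' (a := fun n =>
      ‖reducedOp G K (fun j => τ j n) (C n) l (f n)‖ / ε) ?_
      (by simpa using (tendsto_zero_iff_norm_tendsto_zero.1 hred).div_const ε)
    have h1 := (h.eventually_window hN hε hlε hiso hε le_rfl).filter_mono h𝒰'
    filter_upwards [h1, hb] with n hn hnb
    obtain ⟨v, hv, hvred⟩ := h.exists_reducedOp_eq n l (f n)
    have h2 := (finrank_rieszRange_and_estimates (h.selfAdjoint_full n) hε hlε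
      (h.spectrum_full n) hn.1 hn.2.1).2.2 v (hv ▸ (hpb n hnb).2)
    rw [← hvred, hv] at h2
    exact (le_div_iff₀' hε).2 h2
  have hq0 : q = 0 := by
    funext k
    refine Subtype.ext (h.injective ?_)
    have h1 : Tendsto (fun n => G (τ k n (f n))) 𝒰 (𝓝 0) := by
      rw [tendsto_zero_iff_norm_tendsto_zero] at hG0 ⊢
      simpa only [h.comm, LinearIsometryEquiv.norm_map] using hG0
    rw [((hw k).map G).unique (WeakTendsto.of_tendsto h1)]
    exact (map_zero G).symm
  rw [hq0, norm_zero] at hq1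
  exact zero_ne_one hq1

/-- The dimensions of the spectral subspaces add up in the limit. -/
theorem eventually_finrank_rieszRange_eq (h : IsDecouplingFamily T L G K C τ δ) (hN : 1 ≤ N)
    {l ε : ℝ} (hε : 0 < ε) (hlε : l + ε < δ)
    (hiso : ∀ s : ℝ, s ≠ l → |s - l| ≤ ε → ∀ j, (s : ℂ) ∈ resolventSet (T j)) :
    (∀ j, Metric.sphere (l : ℂ) ε ⊆ resolventSet (T j) ∧
      FiniteDimensional ℂ (rieszRange (T j) l ε)) ∧
    ∀ᶠ n in atTop, Metric.sphere (l : ℂ) ε ⊆ resolventSet (L n) ∧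
      FiniteDimensional ℂ (rieszRange (L n) l ε) ∧
      Module.finrank ℂ (rieszRange (L n) l ε) =
        ∑ j, Module.finrank ℂ (rieszRange (T j) l ε) := by
  have hr : ∀ j, ((l + ε : ℝ) : ℂ) ∈ resolventSet (T j) :=
    hiso _ (by linarith) (by rw [add_sub_cancel_left, abs_of_pos hε])
  have hl : ∀ j, ((l - ε : ℝ) : ℂ) ∈ resolventSet (T j) :=
    hiso _ (by linarith) (by rw [abs_sub_comm, sub_sub_cancel, abs_of_pos hε])
  have hT := fun j => finrank_rieszRange_and_estimates (h.selfAdjoint_limit j) hε hlε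
    (h.spectrum_limit j) (hr j) (hl j)
  refine ⟨fun j => ⟨sphere_subset_resolventSet (h.selfAdjoint_limit j) (hr j) (hl j),
    (hT j).1.1⟩, ?_⟩
  have hwin : ∀ j, windowSpace (T j) l ε = eigenspace (T j) l := by
    intro j
    refine le_antisymm (iSup_le fun s => ?_) (le_iSup (fun s : Metric.ball l ε =>
      eigenspace (T j) s) ⟨l, Metric.mem_ball_self hε⟩)
    by_cases hs : (s : ℝ) = l
    · rw [hs]
    · rw [eigenspace_eq_bot_of_mem_resolventSet (hiso s hs (le_of_lt s.2) j)]
      exact bot_le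
  have hEfd : ∀ j, FiniteDimensional ℝ (eigenspace (T j) l) := fun j =>
    hwin j ▸ finiteDimensional_windowSpace (h.spectrum_limit j) hlε.le
  let M : Fin N → Submodule ℝ X := fun j => (eigenspace (T j) l).comap (G : X →ₗ[ℝ] X)
  have hM : ∀ j, FiniteDimensional ℝ (M j) ∧
      Module.finrank ℝ (M j) = Module.finrank ℝ (eigenspace (T j) l) := fun j =>
    finrank_comap_of_injective h.injective fun x hx =>
      h.domain_limit j x (mem_eigenspace_iff.1 hx).1
  filter_upwards [h.eventually_window hN hε hlε hiso hε le_rfl,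
    h.eventually_finrank_le hN hε hlε hiso (M := M) (fun j f => Iff.rfl) fun j => (hM j).1,
    h.eventually_le_finrank hN hε hlε hiso (M := M) (fun j f => Iff.rfl) fun j => (hM j).1]
    with n hn hle hge
  have hLn := finrank_rieszRange_and_estimates (h.selfAdjoint_full n) hε hlε
    (h.spectrum_full n) hn.1 hn.2.1
  have hWfd : FiniteDimensional ℝ (windowSpace (L n) l ε) :=
    finiteDimensional_windowSpace (h.spectrum_full n) hlε.le
  rw [(finrank_comap_of_injective h.injective fun x hx =>
    h.domain_full n x (windowSpace_le_domain _ _ _ hx)).2] at hle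
  refine ⟨sphere_subset_resolventSet (h.selfAdjoint_full n) hn.1 hn.2.1, hLn.1.1, ?_⟩
  rw [hLn.1.2, le_antisymm hle hge]
  refine Finset.sum_congr rfl fun j _ => ?_
  rw [(hT j).1.2, (hM j).2, hwin]

end IsDecouplingFamily

end Counting

end AsymptoticInertia

theorem theorem4p3 {X : Type*} [NormedAddCommGroup X] [InnerProductSpace ℝ X] [CompleteSpace X]
    {N : ℕ} (hN : 1 ≤ N)
    (A : X →ₗ.[ℝ] X) (B : Fin N → X →ₗ.[ℝ] X) (R : ℕ → X →ₗ.[ℝ] X)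
    (τ : Fin N → ℕ → X ≃ₗᵢ[ℝ] X) (δ : ℝ) (hδ : 0 < δ)
    -- (A1) self-adjointness, with the common domain `D(A)`
    (hA : IsSelfAdjoint A)
    (hAB : ∀ j, IsSelfAdjoint (A + B j) ∧ (A + B j).domain = A.domain)
    (hABn : ∀ j n, IsSelfAdjoint (A + AsymptoticInertia.conj (τ j n) (B j)) ∧
      (A + AsymptoticInertia.conj (τ j n) (B j)).domain = A.domain)
    (hL : ∀ n, IsSelfAdjoint (AsymptoticInertia.fullOp A B R τ n) ∧
      (AsymptoticInertia.fullOp A B R τ n).domain = A.domain)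
    -- (A2) `A` is invertible and commutes with the isometries
    (hAinv : (0 : ℂ) ∈ AsymptoticInertia.resolventSet A)
    (hAτ : ∀ j n, AsymptoticInertia.conj (τ j n) A = A)
    -- (A3) finitely many eigenvalues of finite multiplicity below `δ`
    (hσA : AsymptoticInertia.FiniteSpectrumBelow A δ)
    (hσAB : ∀ j, AsymptoticInertia.FiniteSpectrumBelow (A + B j) δ)
    (hσABn : ∀ j n,
      AsymptoticInertia.FiniteSpectrumBelow (A + AsymptoticInertia.conj (τ j n) (B j)) δ)
    (hσL : ∀ n, AsymptoticInertia.FiniteSpectrumBelow (AsymptoticInertia.fullOp A B R τ n) δ)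
    -- (A4) `A (A + Bʲ - μ)⁻¹` is bounded
    (hres : ∀ μ : ℂ, (∀ j, μ ∈ AsymptoticInertia.resolventSet (A + B j)) → ∀ j,
      ∃ C : AsymptoticInertia.Complexification X →L[ℂ] AsymptoticInertia.Complexification X,
        AsymptoticInertia.IsGivenBy
          (AsymptoticInertia.opComp (AsymptoticInertia.complexify A)
            (LinearMap.toPMap (AsymptoticInertia.resolvent (A + B j) μ :
              AsymptoticInertia.Complexification X →ₗ[ℂ] AsymptoticInertia.Complexification X)
              ⊤)) C)
    -- (A5) `‖R_n A⁻¹‖ → 0`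
    (hR : ∃ C : ℕ → X →L[ℝ] X,
      (∀ n, AsymptoticInertia.IsGivenBy (AsymptoticInertia.opComp (R n) A.inverse) (C n)) ∧
      Filter.Tendsto (fun n => ‖C n‖) Filter.atTop (nhds 0))
    -- (A6) `‖τ^{j/l}_n Bˡ τ^{l/j}_n u‖ → 0` for `u ∈ D(A)`
    (hBsep : ∀ u ∈ A.domain, ∀ j l, j ≠ l →
      ∃ hu : ∀ n, u ∈ (AsymptoticInertia.conj
          (AsymptoticInertia.isomQuot (τ l n) (τ j n)) (B l)).domain,
        Filter.Tendsto (fun n => ‖AsymptoticInertia.conj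
          (AsymptoticInertia.isomQuot (τ l n) (τ j n)) (B l) ⟨u, hu n⟩‖)
          Filter.atTop (nhds 0))
    -- (A7) `τ^{j/k}_n u ⇀ 0` weakly
    (hτsep : ∀ u : X, ∀ j k, j ≠ k →
      Filter.Tendsto
        (fun n => toWeakSpace ℝ X (AsymptoticInertia.isomQuot (τ j n) (τ k n) u))
        Filter.atTop (nhds 0))
    -- (A8) `Bʲ A⁻¹` is compact
    (hcomp : ∀ j, ∃ C : X →L[ℝ] X,
      AsymptoticInertia.IsGivenBy (AsymptoticInertia.opComp (B j) A.inverse) C ∧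
      IsCompactOperator C)
    (lam : ℝ) (hlam : lam < δ) :
    ((∀ j, (lam : ℂ) ∈ AsymptoticInertia.resolventSet (A + B j)) →
      ∃ n₀ : ℕ, ∀ n ≥ n₀,
        (lam : ℂ) ∈ AsymptoticInertia.resolventSet (AsymptoticInertia.fullOp A B R τ n)) ∧
    ((∃ j, (lam : ℂ) ∈ AsymptoticInertia.spectrum (A + B j)) →
      ∃ ε₀ : ℝ, 0 < ε₀ ∧ ∀ ε : ℝ, 0 < ε → ε < ε₀ →
        -- the circle lies in the resolvent sets, and the projections have finite rank
        (∀ j, Metric.sphere (lam : ℂ) ε ⊆ AsymptoticInertia.resolventSet (A + B j) ∧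
          FiniteDimensional ℂ (AsymptoticInertia.rieszRange (A + B j) lam ε)) ∧
        ∃ n₀ : ℕ, ∀ n ≥ n₀,
          Metric.sphere (lam : ℂ) ε ⊆
            AsymptoticInertia.resolventSet (AsymptoticInertia.fullOp A B R τ n) ∧
          FiniteDimensional ℂ
            (AsymptoticInertia.rieszRange (AsymptoticInertia.fullOp A B R τ n) lam ε) ∧
          Module.finrank ℂ
              (AsymptoticInertia.rieszRange (AsymptoticInertia.fullOp A B R τ n) lam ε) =
            ∑ j, Module.finrank ℂ (AsymptoticInertia.rieszRange (A + B j) lam ε)) := by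
  obtain ⟨G, hAG, hGA⟩ := AsymptoticInertia.exists_bounded_inverse hAinv
  obtain ⟨C, hC, hC0⟩ := hR
  choose K hK hKc using hcomp
  have hdomain : ∀ x ∈ A.domain, ∃ f, G f = x := fun x hx => ⟨A ⟨x, hx⟩, hGA ⟨x, hx⟩⟩
  have hcomm : ∀ j n x, G (τ j n x) = τ j n (G x) := fun j n x =>
    AsymptoticInertia.commute_of_conj_eq hAG hGA (hAτ j n) x
  have hBG : ∀ j f, AsymptoticInertia.Maps (B j) (G f) (K j f) := fun j f =>
    AsymptoticInertia.maps_of_isGivenBy_comp_inverse hAG hGA (hK j) f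
  have h : AsymptoticInertia.IsDecouplingFamily (fun j => A + B j)
      (AsymptoticInertia.fullOp A B R τ) G K C τ δ :=
    { injective := fun x y hxy => by
        obtain ⟨h1, h2⟩ := hAG x
        obtain ⟨h3, h4⟩ := hAG y
        rw [← h2, ← h4]
        exact congrArg A (Subtype.ext hxy)
      comm := hcomm
      proper := fun μ hμ 𝒰 r c hr hr0 h =>
        AsymptoticInertia.tendsto_zero_of_sub_smul_tendsto_zero hA hσA hμ hAG hr hr0 h
      compact := hKc
      norm_tendsto := hC0
      separation := fun u j k hjk =>
        AsymptoticInertia.weakTendsto_of_toWeakSpace (hτsep u j k hjk)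
      selfAdjoint_limit := fun j => (hAB j).1
      spectrum_limit := hσAB
      maps_limit := fun j f => (hAG f).add (hBG j f)
      domain_limit := fun j x hx => hdomain x ((hAB j).2 ▸ hx)
      selfAdjoint_full := fun n => (hL n).1
      spectrum_full := hσL
      maps_full := fun n f => ((hAG f).add (AsymptoticInertia.Maps.sum fun j _ =>
        AsymptoticInertia.Maps.conj (by rw [← hcomm]; exact hBG j _))).add
          (AsymptoticInertia.maps_of_isGivenBy_comp_inverse hAG hGA (hC n) f)
      domain_full := fun n x hx => hdomain x ((hL n).2 ▸ hx) }
  refine ⟨fun hlamT => ?_, fun _ => ?_⟩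
  · obtain ⟨n₀, hn₀⟩ := eventually_atTop.1 (h.eventually_mem_resolventSet hN
      (isCompact_singleton (x := lam)) (by simpa using hlam) (by simpa using hlamT))
    exact ⟨n₀, fun n hn => hn₀ n hn lam rfl⟩
  · choose r hr hrδ hiso using fun j =>
      AsymptoticInertia.exists_isolating_radius (hσAB j) hlam
    have hne : (Finset.univ : Finset (Fin N)).Nonempty := ⟨⟨0, hN⟩, Finset.mem_univ _⟩
    refine ⟨Finset.univ.inf' hne r, (Finset.lt_inf'_iff hne).2 fun j _ => hr j,
      fun ε hε hεr => ?_⟩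
    have hεj : ∀ j, ε < r j := fun j => (Finset.lt_inf'_iff hne).1 hεr j (Finset.mem_univ j)
    have hlε : lam + ε < δ := by linarith [hεj ⟨0, hN⟩, hrδ ⟨0, hN⟩]
    obtain ⟨h1, h2⟩ := h.eventually_finrank_rieszRange_eq hN hε hlε
      fun s hs hsl j => hiso j s hs (hsl.trans_lt (hεj j))
    exact ⟨h1, eventually_atTop.1 h2⟩
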